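/- Let $G=(V,E)$ be a finite simple graph with $n$ vertices and maximum degree $\Delta$. The operator norm $\rho(G)$ is the Euclidean operator norm of the adjacency matrix of $G$. The Glauber dynamics on the set $\Omega$ of proper $k$-colorings $X:V\to\{1,\dots,k\}$ of $G$ is the Markov chain that at each step chooses a vertex $v\in V$ uniformly at random and recolors it with a color chosen uniformly at random from $\{1,\dots,k\}\setminus X(N(v))$, the colors not appearing in its neighborhood. Its mixing time is the least number of steps $t$ such that, from every initial coloring, the law of the chain after $t$ steps is within total variation distance $1/4$ of the uniform distribution on $\Omega$, which is stationary for the chain. **Theorem.** For every $\varepsilon>0$ and every $c>0$ there are constants $C$ and $N$, depending only on $\varepsilon$ and $c$, such that the following holds. Let $G$ be a graph with $n\ge N$ vertices, maximum degree $\Delta$ and operator norm $\rho(G)\le\Delta^{1-\varepsilon}$, such that $\Delta\ge c\,(\ln n)^{1+\varepsilon}$. Then for every integer $k>4\varepsilon^{-1}\Delta/\ln\Delta$, the graph $G$ has a proper $k$-coloring, and the mixing time of the Glauber dynamics on the proper $k$-colorings of $G$ is at most $C\,n\ln n$. -/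

import Mathlib

section MarkovChains

variable {S : Type*} [Fintype S]

/-- The total variation distance of two (probability) vectors on a finite set. -/
noncomputable def tvDist (μ ν : S → ℝ) : ℝ :=
  (1 / 2) * ∑ s, |μ s - ν s|

/-- The uniform probability vector on a finite set. -/
noncomputable def uniformDist (S : Type*) [Fintype S] : S → ℝ :=
  fun _ => 1 / (Fintype.card S : ℝ)

/-- The mixing time of the chain with transition matrix `P` and stationary distribution `π`:
the least `t` such that from every initial state the law after `t` steps is within total
variation distance `1/4` of `π`, and `⊤` if there is no such `t`. -/
noncomputable def mixingTime [DecidableEq S] (P : Matrix S S ℝ) (π : S → ℝ) : ℕ∞ :=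
  sInf {τ : ℕ∞ | ∃ t : ℕ, τ = (t : ℕ∞) ∧ ∀ x : S, tvDist ((P ^ t) x) π ≤ 1 / 4}

end MarkovChains

section Glauber

variable {V : Type*} [Fintype V] [DecidableEq V] (G : SimpleGraph V) [DecidableRel G.Adj]

/-- The colors available for `v` in the coloring `f`: those that no neighbor of `v` has. -/
def availableColors {k : ℕ} (f : V → Fin k) (v : V) : Finset (Fin k) :=
  Finset.univ \ (G.neighborFinset v).image f

/-- The transition matrix of the Glauber dynamics on the proper `k`-colorings of `G`: choose a
vertex `v` uniformly at random, then recolor it with a color chosen uniformly at random from the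
colors available for `v` in the present coloring. -/
noncomputable def glauberMatrix (k : ℕ) :
    Matrix (G.Coloring (Fin k)) (G.Coloring (Fin k)) ℝ :=
  fun X Y => ∑ v : V, (1 / (Fintype.card V : ℝ)) *
    ∑ c ∈ availableColors G X v, (1 / ((availableColors G X v).card : ℝ)) *
      if Function.update (X : V → Fin k) v c = (Y : V → Fin k) then 1 else 0

open Classical in
/-- The mixing time of the Glauber dynamics on the proper `k`-colorings of `G`, whose stationary
distribution is uniform. -/
noncomputable def glauberMixingTime (k : ℕ) : ℕ∞ :=
  mixingTime (glauberMatrix G k) (uniformDist (G.Coloring (Fin k)))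

/-- The operator norm of `G`: the Euclidean operator norm of its adjacency matrix. -/
noncomputable def graphOpNorm : ℝ :=
  ‖Matrix.toEuclideanCLM (n := V) (𝕜 := ℝ) (G.adjMatrix ℝ)‖

end Glauber

/-!
The chain started at an arbitrary coloring `y` is coupled with a chain started at a uniformly random
coloring, so that the second chain is uniform at each time. Both update the same vertex `v`, with
maximally coupled colors. If at least `a` colors are available for `v` in the stationary chain, the
new colors differ with probability at most `1 / a` times the number of neighbors of `v` at which the
chains differ (`exists_color_coupling`); nothing is required of the other chain. Hence the vector of
the disagreement probabilities contracts in the Euclidean norm once `a` is twice the operator norm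
of `G`, up to the vector of the probabilities (`scarcity`) that fewer than `a` colors are available
for `v` in a uniformly random coloring (`exists_coupling`).

It remains to see that the scarcity vector `p` is tiny for `a = Δ ^ (1 - ε / 2)`. Heat-bath updates
at the neighbors of `v`, one after another, preserve the uniform distribution. If fewer than `a`
neighbors of `v` are short of colors before the resampling, then the colors chosen by nearly all
neighbors are dominated by fixed laws of small maximal probability: the operator norm bounds the
number of edges inside the neighborhood, so the updates hardly influence each other. A product
potential is then a supermartingale (`average_prod_le`, `heatBathList_prod_le`) and shows that the
number of colors missing from the neighborhood is below `a` with exponentially small probability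
`η`, as the expected number is at least `k * exp (-(3 / 2 * Δ / k))`, which is much more than `a`
(`heatBathList_card_availableColors_lt`). With Markov's inequality for the other case,
`p v ≤ (1 / a) * ∑ u ∈ N(v), p u + η` (`scarcity_le`); since `a` is twice the operator norm, the
Euclidean norm of `p` is at most `2 * η * √n` (`l2norm_scarcity_le`), with no burn-in needed.

Colorability holds because each induced subgraph has a vertex whose degree is at most the operator
norm (`colorable_of_graphOpNorm_lt`). The case `ε > 1 / 2` is vacuous, as the operator norm is at
least `√Δ` (`le_half_of_graphOpNorm_le`).
-/

/-! ### The Euclidean norm and the operator norm of a graph -/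

/-- The Euclidean norm of a vector given as a plain function (whose own norm is the sup norm). -/
noncomputable def l2norm {V : Type*} [Fintype V] (x : V → ℝ) : ℝ :=
  ‖(WithLp.toLp 2 x : EuclideanSpace ℝ V)‖

section L2

variable {V : Type*} [Fintype V]

lemma l2norm_eq (x : V → ℝ) : l2norm x = √(∑ v, x v ^ 2) := by
  simp [l2norm, EuclideanSpace.norm_eq]

lemma l2norm_nonneg (x : V → ℝ) : 0 ≤ l2norm x := norm_nonneg _

lemma l2norm_mono {x y : V → ℝ} (hx : ∀ v, 0 ≤ x v) (hxy : ∀ v, x v ≤ y v) :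
    l2norm x ≤ l2norm y := by
  rw [l2norm_eq, l2norm_eq]
  exact Real.sqrt_le_sqrt (Finset.sum_le_sum fun v _ => pow_le_pow_left₀ (hx v) (hxy v) 2)

lemma l2norm_add_le (x y : V → ℝ) : l2norm (fun v => x v + y v) ≤ l2norm x + l2norm y :=
  norm_add_le (WithLp.toLp 2 x : EuclideanSpace ℝ V) (WithLp.toLp 2 y)

lemma l2norm_const_mul (c : ℝ) (hc : 0 ≤ c) (x : V → ℝ) :
    l2norm (fun v => c * x v) = c * l2norm x := by
  have h := norm_smul c (WithLp.toLp 2 x : EuclideanSpace ℝ V)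
  rw [Real.norm_of_nonneg hc] at h
  exact h

lemma l2norm_const (c : ℝ) (hc : 0 ≤ c) :
    l2norm (fun _ : V => c) = √(Fintype.card V) * c := by
  rw [l2norm_eq, Finset.sum_const, nsmul_eq_mul, Real.sqrt_mul (by positivity),
    Real.sqrt_sq hc, Finset.card_univ]

lemma sum_le_sqrt_card_mul_l2norm (x : V → ℝ) :
    ∑ v, x v ≤ √(Fintype.card V) * l2norm x := by
  rw [l2norm_eq, ← Real.sqrt_mul (by positivity)]
  apply Real.le_sqrt_of_sq_le
  simpa using sq_sum_le_card_mul_sum_sq (s := Finset.univ) (f := x)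

variable [DecidableEq V] (G : SimpleGraph V) [DecidableRel G.Adj]

lemma graphOpNorm_nonneg : 0 ≤ graphOpNorm G := norm_nonneg _

lemma l2norm_neighbor_sum_le (x : V → ℝ) :
    l2norm (fun v => ∑ u ∈ G.neighborFinset v, x u) ≤ graphOpNorm G * l2norm x := by
  have h := (Matrix.toEuclideanCLM (n := V) (𝕜 := ℝ) (G.adjMatrix ℝ)).le_opNorm (WithLp.toLp 2 x)
  rw [Matrix.toEuclideanCLM_toLp] at h
  have : (G.adjMatrix ℝ).mulVec x = fun v => ∑ u ∈ G.neighborFinset v, x u := by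
    ext v
    exact SimpleGraph.adjMatrix_mulVec_apply G v x
  rw [this] at h
  exact h

/-- The average degree of an induced subgraph is at most the operator norm. -/
lemma sum_card_neighborFinset_inter_le (S : Finset V) :
    ∑ u ∈ S, ((G.neighborFinset u ∩ S).card : ℝ) ≤ graphOpNorm G * S.card := by
  let x : V → ℝ := fun v => if v ∈ S then 1 else 0
  have hx : l2norm x = √(S.card) := by
    rw [l2norm_eq]
    congr 1
    simp [x]
  have h1 : ∑ u ∈ S, ((G.neighborFinset u ∩ S).card : ℝ)
      = ∑ v, x v * ∑ u ∈ G.neighborFinset v, x u := by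
    simp [x]
  rw [h1]
  calc ∑ v, x v * ∑ u ∈ G.neighborFinset v, x u
      ≤ l2norm x * l2norm (fun v => ∑ u ∈ G.neighborFinset v, x u) := by
        rw [l2norm_eq, l2norm_eq]
        exact Real.sum_mul_le_sqrt_mul_sqrt _ _ _
    _ ≤ l2norm x * (graphOpNorm G * l2norm x) :=
        mul_le_mul_of_nonneg_left (l2norm_neighbor_sum_le G x) (l2norm_nonneg _)
    _ = graphOpNorm G * S.card := by
        rw [hx, mul_left_comm, Real.mul_self_sqrt (by positivity)]

lemma degree_le_graphOpNorm_sq (v : V) : (G.degree v : ℝ) ≤ graphOpNorm G ^ 2 := by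
  let x : V → ℝ := Pi.single v 1
  have hx : l2norm x = 1 := by
    rw [l2norm_eq]
    simp [x, Pi.single_apply]
  have h := l2norm_neighbor_sum_le G x
  rw [hx, mul_one] at h
  have h2 : l2norm (fun w => ∑ u ∈ G.neighborFinset w, x u) = √(G.degree v) := by
    rw [l2norm_eq]
    congr 1
    simp only [x, Pi.single_apply, Finset.sum_ite_eq', SimpleGraph.mem_neighborFinset]
    simp only [ite_pow, one_pow, ne_eq, OfNat.ofNat_ne_zero, not_false_eq_true, zero_pow,
      Finset.sum_boole]
    norm_cast
    rw [← SimpleGraph.card_neighborFinset_eq_degree]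
    congr 1
    ext w
    simp [SimpleGraph.adj_comm]
  rw [h2] at h
  exact (Real.sqrt_le_left (graphOpNorm_nonneg G)).1 h

/-- A graph is colorable with more colors than its operator norm, since each induced subgraph has
a vertex of degree less than the number of colors. -/
lemma colorable_of_graphOpNorm_lt {k : ℕ} (hk : graphOpNorm G < k) : G.Colorable k := by
  have hkpos : 0 < k := by
    have := (graphOpNorm_nonneg G).trans_lt hk
    exact_mod_cast this
  have key : ∀ (m : ℕ) (S : Finset V), S.card = m →
      ∃ f : V → Fin k, ∀ u ∈ S, ∀ w ∈ S, G.Adj u w → f u ≠ f w := by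
    intro m
    induction m with
    | zero =>
      intro S hS
      rw [Finset.card_eq_zero] at hS
      exact ⟨fun _ => ⟨0, hkpos⟩, by simp [hS]⟩
    | succ m ih =>
      intro S hS
      obtain ⟨v, hvS, hv⟩ : ∃ v ∈ S, (G.neighborFinset v ∩ S).card < k := by
        by_contra! hcon
        have h1 := sum_card_neighborFinset_inter_le G S
        have h2 : ∑ u ∈ S, (k : ℝ) ≤ ∑ u ∈ S, ((G.neighborFinset u ∩ S).card : ℝ) :=
          Finset.sum_le_sum fun u hu => by exact_mod_cast hcon u hu
        rw [Finset.sum_const, nsmul_eq_mul] at h2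
        have h3 : (0 : ℝ) < S.card := by rw [hS]; positivity
        nlinarith
      obtain ⟨f, hf⟩ := ih (S.erase v) (by rw [Finset.card_erase_of_mem hvS, hS]; rfl)
      obtain ⟨c, hc⟩ : ∃ c, c ∉ (G.neighborFinset v ∩ S).image f := by
        by_contra! hcon
        have : (Finset.univ : Finset (Fin k)).card ≤ ((G.neighborFinset v ∩ S).image f).card :=
          Finset.card_le_card fun c _ => hcon c
        have h2 := Finset.card_image_le (s := G.neighborFinset v ∩ S) (f := f)
        simp only [Finset.card_univ, Fintype.card_fin] at this
        omega
      have hc' : ∀ w ∈ S, G.Adj v w → f w ≠ c := by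
        intro w hw hvw h
        exact hc (Finset.mem_image.2 ⟨w, by simp [hw, hvw], h⟩)
      refine ⟨Function.update f v c, fun u hu w hw huw => ?_⟩
      by_cases huv : u = v
      · subst huv
        rw [Function.update_self, Function.update_of_ne huw.ne']
        exact (hc' w hw huw).symm
      · by_cases hwv : w = v
        · subst hwv
          rw [Function.update_self, Function.update_of_ne huv]
          exact hc' u hu huw.symm
        · rw [Function.update_of_ne huv, Function.update_of_ne hwv]
          exact hf u (Finset.mem_erase.2 ⟨huv, hu⟩) w (Finset.mem_erase.2 ⟨hwv, hw⟩) huw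
  obtain ⟨f, hf⟩ := key _ Finset.univ rfl
  exact ⟨SimpleGraph.Coloring.mk f fun {u w} h => hf u (Finset.mem_univ _) w (Finset.mem_univ _) h⟩

end L2

/-! ### Heat-bath updates -/

section HeatBath

variable {V : Type*} [Fintype V] {G : SimpleGraph V} [DecidableRel G.Adj] {k : ℕ}

lemma mem_availableColors {f : V → Fin k} {v : V} {c : Fin k} :
    c ∈ availableColors G f v ↔ ∀ w, G.Adj v w → f w ≠ c := by
  simp [availableColors]

lemma coloring_mem_availableColors (X : G.Coloring (Fin k)) (v : V) :
    X v ∈ availableColors G X v :=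
  mem_availableColors.2 fun _ h => (X.valid h).symm

lemma card_availableColors_pos (X : G.Coloring (Fin k)) (v : V) :
    0 < (availableColors G X v).card :=
  Finset.card_pos.2 ⟨_, coloring_mem_availableColors X v⟩

lemma availableColors_congr {f g : V → Fin k} {v : V} (h : ∀ w, w ≠ v → f w = g w) :
    availableColors G f v = availableColors G g v := by
  ext c
  rw [mem_availableColors, mem_availableColors]
  exact forall₂_congr fun w hw => by rw [h w hw.ne']

variable [DecidableEq V]

/-- The coloring `X` with the color of `v` changed to `c`; it is `X` itself if `c` is not
available for `v`. -/
def recolor (X : G.Coloring (Fin k)) (v : V) (c : Fin k) : G.Coloring (Fin k) :=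
  if h : c ∈ availableColors G X v then
    SimpleGraph.Coloring.mk (Function.update X v c) (by
      intro u w huw
      rw [mem_availableColors] at h
      by_cases huv : u = v
      · subst huv
        rw [Function.update_self, Function.update_of_ne huw.ne']
        exact (h w huw).symm
      · by_cases hwv : w = v
        · subst hwv
          rw [Function.update_self, Function.update_of_ne huv]
          exact h u huw.symm
        · rw [Function.update_of_ne huv, Function.update_of_ne hwv]
          exact X.valid huw)
  else X

lemma coe_recolor {X : G.Coloring (Fin k)} {v : V} {c : Fin k}
    (h : c ∈ availableColors G X v) :
    (recolor X v c : V → Fin k) = Function.update X v c := by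
  rw [recolor, dif_pos h]
  rfl

lemma recolor_self {X : G.Coloring (Fin k)} {v : V} {c : Fin k}
    (h : c ∈ availableColors G X v) : recolor X v c v = c := by
  rw [coe_recolor h, Function.update_self]

lemma recolor_of_ne (X : G.Coloring (Fin k)) {v w : V} (c : Fin k) (h : w ≠ v) :
    recolor X v c w = X w := by
  by_cases hc : c ∈ availableColors G X v
  · rw [coe_recolor hc, Function.update_of_ne h]
  · rw [recolor, dif_neg hc]

/-- The heat-bath operator at `v`: the expectation of `f` after `v` has been recolored with a
uniformly random available color. -/
noncomputable def heatBath (v : V) (f : G.Coloring (Fin k) → ℝ) (X : G.Coloring (Fin k)) : ℝ :=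
  ∑ c ∈ availableColors G X v, (1 / ((availableColors G X v).card : ℝ)) * f (recolor X v c)

lemma heatBath_mono (v : V) {f g : G.Coloring (Fin k) → ℝ} {X : G.Coloring (Fin k)}
    (h : ∀ c ∈ availableColors G X v, f (recolor X v c) ≤ g (recolor X v c)) :
    heatBath v f X ≤ heatBath v g X :=
  Finset.sum_le_sum fun c hc => mul_le_mul_of_nonneg_left (h c hc) (by positivity)

lemma heatBath_const (v : V) (r : ℝ) (X : G.Coloring (Fin k)) :
    heatBath v (fun _ => r) X = r := by
  have := card_availableColors_pos X v
  rw [heatBath, Finset.sum_const, nsmul_eq_mul]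
  field_simp

/-- The heat-bath operator as an average over the colorings that agree with `X` off `v`. -/
lemma heatBath_eq_sum (v : V) (f : G.Coloring (Fin k) → ℝ) (X : G.Coloring (Fin k)) :
    heatBath v f X = ∑ Y : G.Coloring (Fin k),
      (if ∀ w, w ≠ v → X w = Y w then 1 / ((availableColors G X v).card : ℝ) else 0) * f Y := by
  simp only [ite_mul, zero_mul]
  rw [← Finset.sum_filter, heatBath]
  refine Finset.sum_bij' (fun c _ => recolor X v c) (fun Y _ => Y v) ?_ ?_ ?_ ?_ ?_
  · intro c _
    simp only [Finset.mem_filter, Finset.mem_univ, true_and]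
    exact fun w hw => (recolor_of_ne X c hw).symm
  · intro Y hY
    simp only [Finset.mem_filter, Finset.mem_univ, true_and] at hY
    rw [availableColors_congr hY]
    exact coloring_mem_availableColors Y v
  · intro c hc
    exact recolor_self hc
  · intro Y hY
    simp only [Finset.mem_filter, Finset.mem_univ, true_and] at hY
    apply DFunLike.ext
    intro w
    by_cases hw : w = v
    · subst hw
      apply recolor_self
      rw [availableColors_congr hY]
      exact coloring_mem_availableColors Y w
    · rw [recolor_of_ne X _ hw, hY w hw]
  · intro c _
    rfl

/-- The uniform distribution is stationary for each heat-bath update, by detailed balance. -/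
lemma sum_heatBath (v : V) (f : G.Coloring (Fin k) → ℝ) :
    ∑ X, heatBath v f X = ∑ X, f X := by
  have hsymm : ∀ X Y : G.Coloring (Fin k),
      (if ∀ w, w ≠ v → X w = Y w then 1 / ((availableColors G X v).card : ℝ) else 0) =
      (if ∀ w, w ≠ v → Y w = X w then 1 / ((availableColors G Y v).card : ℝ) else 0) := by
    intro X Y
    by_cases h : ∀ w, w ≠ v → X w = Y w
    · rw [if_pos h, if_pos fun w hw => (h w hw).symm, availableColors_congr h]
    · rw [if_neg h, if_neg fun h' => h fun w hw => (h' w hw).symm]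
  simp_rw [heatBath_eq_sum]
  rw [Finset.sum_comm]
  refine Finset.sum_congr rfl fun Y _ => ?_
  rw [← Finset.sum_mul]
  simp_rw [fun X => hsymm X Y]
  have h := heatBath_eq_sum v (fun _ => (1 : ℝ)) Y
  rw [heatBath_const] at h
  simp only [mul_one] at h
  rw [← h, one_mul]

/-- Heat-bath updates at the vertices of a list, its head being updated first. -/
noncomputable def heatBathList : List V → (G.Coloring (Fin k) → ℝ) → G.Coloring (Fin k) → ℝ
  | [], f => f
  | v :: L, f => heatBath v (heatBathList L f)

lemma sum_heatBathList (L : List V) (f : G.Coloring (Fin k) → ℝ) :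
    ∑ X, heatBathList L f X = ∑ X, f X := by
  induction L with
  | nil => rfl
  | cons v L ih => rw [heatBathList, sum_heatBath, ih]

lemma heatBathList_mono (L : List V) {f g : G.Coloring (Fin k) → ℝ} (h : ∀ X, f X ≤ g X)
    (X : G.Coloring (Fin k)) : heatBathList L f X ≤ heatBathList L g X := by
  induction L generalizing X with
  | nil => exact h X
  | cons v L ih => exact heatBath_mono v fun c _ => ih _

lemma heatBathList_const (L : List V) (r : ℝ) (X : G.Coloring (Fin k)) :
    heatBathList L (fun _ => r) X = r := by
  induction L generalizing X with
  | nil => rfl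
  | cons v L ih =>
    rw [heatBathList, show heatBathList L (fun _ => r) = fun _ => r from funext ih,
      heatBath_const]

lemma heatBathList_const_mul (L : List V) (r : ℝ) (f : G.Coloring (Fin k) → ℝ)
    (X : G.Coloring (Fin k)) :
    heatBathList L (fun Y => r * f Y) X = r * heatBathList L f X := by
  induction L generalizing X with
  | nil => rfl
  | cons v L ih =>
    simp only [heatBathList, heatBath, ih, Finset.mul_sum]
    exact Finset.sum_congr rfl fun c _ => by ring

/-- One step of the Glauber dynamics is a heat-bath update at a uniformly random vertex. -/
lemma glauberMatrix_apply (X Y : G.Coloring (Fin k)) :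
    glauberMatrix G k X Y = ∑ v : V, (1 / (Fintype.card V : ℝ)) *
      ∑ c ∈ availableColors G X v, (1 / ((availableColors G X v).card : ℝ)) *
        if recolor X v c = Y then 1 else 0 := by
  unfold glauberMatrix
  refine Finset.sum_congr rfl fun v _ => ?_
  congr 1
  refine Finset.sum_congr rfl fun c hc => ?_
  congr 1
  rw [← coe_recolor hc]
  simp only [DFunLike.coe_fn_eq]

lemma sum_glauberMatrix_left (hV : 0 < Fintype.card V) (Y : G.Coloring (Fin k)) :
    ∑ X, glauberMatrix G k X Y = 1 := by
  have hn : (Fintype.card V : ℝ) ≠ 0 := by positivity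
  simp_rw [glauberMatrix_apply]
  rw [Finset.sum_comm]
  have : ∀ v : V, ∑ X : G.Coloring (Fin k), (1 / (Fintype.card V : ℝ)) *
      ∑ c ∈ availableColors G X v, (1 / ((availableColors G X v).card : ℝ)) *
        (if recolor X v c = Y then 1 else 0) = 1 / (Fintype.card V : ℝ) := by
    intro v
    rw [← Finset.mul_sum]
    have h := sum_heatBath v (fun Z : G.Coloring (Fin k) => if Z = Y then (1 : ℝ) else 0)
    unfold heatBath at h
    rw [h]
    simp
  rw [Finset.sum_congr rfl fun v _ => this v, Finset.sum_const, nsmul_eq_mul, Finset.card_univ]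
  field_simp

end HeatBath

/-! ### The number of available colors after resampling a neighborhood -/

section Resampling

lemma one_add_sum_le_prod {ι : Type*} (s : Finset ι) (f : ι → ℝ) (hf : ∀ i, 0 ≤ f i) :
    1 + ∑ i ∈ s, f i ≤ ∏ i ∈ s, (1 + f i) := by
  classical
  induction s using Finset.induction_on with
  | empty => simp
  | insert i s hi ih =>
    rw [Finset.sum_insert hi, Finset.prod_insert hi]
    have h1 := hf i
    have h2 : 0 ≤ ∑ j ∈ s, f j := Finset.sum_nonneg fun j _ => hf j
    nlinarith

variable {ι : Type*} [Fintype ι] [DecidableEq ι]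

lemma prod_ite_eq_div (x : ι → ℝ) (hx : ∀ j, x j ≤ 1 / 2) (c : ι) :
    ∏ j, (if j = c then 1 else 1 - x j) = (∏ j, (1 - x j)) / (1 - x c) := by
  have hc : 1 - x c ≠ 0 := by have := hx c; intro h; linarith
  rw [eq_div_iff hc, ← Finset.mul_prod_erase _ _ (Finset.mem_univ c),
    ← Finset.mul_prod_erase _ (fun j => 1 - x j) (Finset.mem_univ c), if_pos rfl, one_mul,
    mul_comm]
  congr 1
  exact Finset.prod_congr rfl fun j hj => if_neg (Finset.ne_of_mem_erase hj)

/-- The supermartingale step: if the color `c` is drawn uniformly from `A`, and `p` dominates the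
law of `c`, then the product potential does not increase on average. -/
lemma average_prod_le (A : Finset ι) (hA : 0 < A.card) (x p : ι → ℝ) (hx0 : ∀ j, 0 ≤ x j)
    (hx : ∀ j, x j ≤ 1 / 2) (hp0 : ∀ j, 0 ≤ p j) (hp : ∀ j ∈ A, 1 / (A.card : ℝ) ≤ p j) :
    ∑ c ∈ A, (1 / (A.card : ℝ)) * ∏ j, (if j = c then 1 else 1 - x j) ≤
      ∏ j, (1 - (1 - p j) * x j) := by
  have hpos : ∀ j, 0 < 1 - x j := fun j => by have := hx j; linarith
  have hP : 0 < ∏ j, (1 - x j) := Finset.prod_pos fun j _ => hpos j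
  have hA' : (A.card : ℝ) ≠ 0 := by positivity
  have hy : ∀ j, 0 ≤ p j * (x j / (1 - x j)) := fun j =>
    mul_nonneg (hp0 j) (div_nonneg (hx0 j) (hpos j).le)
  calc ∑ c ∈ A, (1 / (A.card : ℝ)) * ∏ j, (if j = c then 1 else 1 - x j)
      = ∑ c ∈ A, (1 / (A.card : ℝ)) * ((∏ j, (1 - x j)) * (1 + x c / (1 - x c))) := by
        refine Finset.sum_congr rfl fun c _ => ?_
        rw [prod_ite_eq_div x hx c]
        have := (hpos c).ne'
        congr 1
        field_simp
        ring
    _ = (∏ j, (1 - x j)) * (1 + ∑ c ∈ A, (1 / (A.card : ℝ)) * (x c / (1 - x c))) := by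
        have h1 : ∑ c ∈ A, (1 / (A.card : ℝ)) = 1 := by
          rw [Finset.sum_const, nsmul_eq_mul]; field_simp
        have h2 : ∀ P : ℝ, P * (1 + ∑ c ∈ A, (1 / (A.card : ℝ)) * (x c / (1 - x c))) =
            P * (∑ c ∈ A, (1 / (A.card : ℝ)) +
              ∑ c ∈ A, (1 / (A.card : ℝ)) * (x c / (1 - x c))) := fun P => by rw [h1]
        rw [h2, ← Finset.sum_add_distrib, Finset.mul_sum]
        exact Finset.sum_congr rfl fun c _ => by ring
    _ ≤ (∏ j, (1 - x j)) * (1 + ∑ j, p j * (x j / (1 - x j))) := by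
        gcongr
        refine le_trans (Finset.sum_le_sum fun c hc => ?_)
          (Finset.sum_le_univ_sum_of_nonneg hy (s := A))
        exact mul_le_mul_of_nonneg_right (hp c hc) (div_nonneg (hx0 c) (hpos c).le)
    _ ≤ (∏ j, (1 - x j)) * ∏ j, (1 + p j * (x j / (1 - x j))) :=
        mul_le_mul_of_nonneg_left (one_add_sum_le_prod _ _ hy) hP.le
    _ = ∏ j, (1 - (1 - p j) * x j) := by
        rw [← Finset.prod_mul_distrib]
        refine Finset.prod_congr rfl fun j _ => ?_
        have := (hpos j).ne'
        field_simp
        ring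

/-- Without control on the law of `c`, the product potential at most doubles. -/
lemma average_prod_le_two_mul (A : Finset ι) (hA : 0 < A.card) (x : ι → ℝ)
    (hx : ∀ j, x j ≤ 1 / 2) :
    ∑ c ∈ A, (1 / (A.card : ℝ)) * ∏ j, (if j = c then 1 else 1 - x j) ≤
      2 * ∏ j, (1 - x j) := by
  have hpos : ∀ j, 0 < 1 - x j := fun j => by have := hx j; linarith
  have hP : 0 < ∏ j, (1 - x j) := Finset.prod_pos fun j _ => hpos j
  have hA' : (A.card : ℝ) ≠ 0 := by positivity
  calc ∑ c ∈ A, (1 / (A.card : ℝ)) * ∏ j, (if j = c then 1 else 1 - x j)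
      ≤ ∑ c ∈ A, (1 / (A.card : ℝ)) * (2 * ∏ j, (1 - x j)) := by
        refine Finset.sum_le_sum fun c _ => mul_le_mul_of_nonneg_left ?_ (by positivity)
        rw [prod_ite_eq_div x hx c, div_le_iff₀ (hpos c)]
        have := hx c
        nlinarith
    _ = 2 * ∏ j, (1 - x j) := by
        rw [Finset.sum_const, nsmul_eq_mul]
        field_simp

end Resampling

section Resampling

variable {V : Type*} [Fintype V] [DecidableEq V] {G : SimpleGraph V} [DecidableRel G.Adj] {k : ℕ}

/-- `1` if the color `j` does not occur on `W`, and `0` otherwise. -/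
def freeIndicator (W : Finset V) (Y : V → Fin k) (j : Fin k) : ℝ :=
  if ∃ w ∈ W, Y w = j then 0 else 1

omit [Fintype V] [DecidableEq V] in
lemma freeIndicator_nonneg (W : Finset V) (Y : V → Fin k) (j : Fin k) :
    0 ≤ freeIndicator W Y j := by
  unfold freeIndicator; split_ifs <;> norm_num

omit [Fintype V] [DecidableEq V] in
lemma freeIndicator_le_one (W : Finset V) (Y : V → Fin k) (j : Fin k) :
    freeIndicator W Y j ≤ 1 := by
  unfold freeIndicator; split_ifs <;> norm_num

lemma freeIndicator_insert_recolor {W : Finset V} {u : V} (hu : u ∉ W) (X : G.Coloring (Fin k))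
    {c : Fin k} (hc : c ∈ availableColors G X u) (j : Fin k) :
    freeIndicator (insert u W) (recolor X u c) j =
      if j = c then 0 else freeIndicator W X j := by
  have hW : ∀ w ∈ W, recolor X u c w = X w := fun w hw =>
    recolor_of_ne X c fun h => hu (h ▸ hw)
  have hiff : (∃ w ∈ insert u W, recolor X u c w = j) ↔ (j = c ∨ ∃ w ∈ W, X w = j) := by
    rw [Finset.exists_mem_insert, recolor_self hc, eq_comm]
    exact or_congr_right (exists_congr fun w => and_congr_right fun hw => by rw [hW w hw])
  unfold freeIndicator
  simp only [hiff]
  by_cases hj : j = c <;> simp [hj]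

/-- Resampling the vertices of `L` one after another: the set `W` has been resampled already, the
law of the color chosen at `u ∈ L` is dominated by `p u` unless `u` is bad, and each bad
vertex costs a factor `2`. -/
lemma heatBathList_prod_le (p : V → Fin k → ℝ) (hp0 : ∀ u j, 0 ≤ p u j) (hp1 : ∀ u j, p u j ≤ 1)
    (bad : V → Prop) [DecidablePred bad] (hbad : ∀ u, bad u → ∀ j, p u j = 0)
    (X₀ : G.Coloring (Fin k)) (S : Finset V)
    (hgood : ∀ u ∈ S, ¬ bad u → ∀ X : G.Coloring (Fin k), (∀ w, w ∉ S → X w = X₀ w) →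
      ∀ j ∈ availableColors G X u, 1 / ((availableColors G X u).card : ℝ) ≤ p u j)
    (L : List V) (hL : L.Nodup) (hLS : ∀ u ∈ L, u ∈ S) (W : Finset V) (hW : ∀ u ∈ L, u ∉ W)
    (X : G.Coloring (Fin k)) (hX : ∀ w, w ∉ S → X w = X₀ w) :
    heatBathList L (fun Y => ∏ j, (1 - 1 / 2 * freeIndicator (W ∪ L.toFinset) Y j)) X ≤
      (L.map fun u => if bad u then (2 : ℝ) else 1).prod *
        ∏ j, (1 - 1 / 2 * freeIndicator W X j * (L.map fun u => 1 - p u j).prod) := by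
  induction L generalizing W X with
  | nil => simp [heatBathList]
  | cons u L ih =>
    rw [List.nodup_cons] at hL
    have huW : u ∉ W := hW u (by simp)
    have huS : u ∈ S := hLS u (by simp)
    set b : ℝ := (L.map fun u => if bad u then (2 : ℝ) else 1).prod with hb
    have hb0 : 0 ≤ b := by
      apply List.prod_nonneg
      intro y hy
      obtain ⟨w, _, rfl⟩ := List.mem_map.1 hy
      split_ifs <;> norm_num
    set Q : Fin k → ℝ := fun j => (L.map fun u => 1 - p u j).prod with hQ
    have hQ0 : ∀ j, 0 ≤ Q j := by
      intro j
      apply List.prod_nonneg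
      intro y hy
      obtain ⟨w, _, rfl⟩ := List.mem_map.1 hy
      linarith [hp1 w j]
    have hQ1 : ∀ j, Q j ≤ 1 := by
      intro j
      have : ∀ L' : List V, (L'.map fun u => 1 - p u j).prod ≤ 1 := by
        intro L'
        induction L' with
        | nil => simp
        | cons w L' ih' =>
          rw [List.map_cons, List.prod_cons]
          have h1 := hp0 w j
          have h2 := hp1 w j
          nlinarith
      exact this L
    set x : Fin k → ℝ := fun j => 1 / 2 * freeIndicator W X j * Q j with hx
    have hx0 : ∀ j, 0 ≤ x j := fun j =>
      mul_nonneg (mul_nonneg (by norm_num) (freeIndicator_nonneg W X j)) (hQ0 j)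
    have hx1 : ∀ j, x j ≤ 1 / 2 := by
      intro j
      have h1 := freeIndicator_nonneg W X j
      have h2 := freeIndicator_le_one W X j
      have h3 : freeIndicator W X j * Q j ≤ 1 := mul_le_one₀ h2 (hQ0 j) (hQ1 j)
      simp only [hx]
      linarith
    have hApos := card_availableColors_pos X u
    -- After the update at `u`, the induction hypothesis applies with `u` moved to `W`.
    have hstep : heatBathList (u :: L)
        (fun Y => ∏ j, (1 - 1 / 2 * freeIndicator (W ∪ (u :: L).toFinset) Y j)) X ≤
        b * ∑ c ∈ availableColors G X u, (1 / ((availableColors G X u).card : ℝ)) *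
          ∏ j, (if j = c then 1 else 1 - x j) := by
      rw [heatBathList, heatBath, Finset.mul_sum]
      refine Finset.sum_le_sum fun c hc => ?_
      have h := ih hL.2 (fun w hw => hLS w (by simp [hw])) (insert u W)
        (fun w hw => by
          rw [Finset.mem_insert, not_or]
          exact ⟨fun h => hL.1 (h ▸ hw), hW w (by simp [hw])⟩)
        (recolor X u c) (fun w hw => by
          rw [recolor_of_ne X c (fun h : w = u => hw (h.symm ▸ huS)), hX w hw])
      have hU : insert u W ∪ L.toFinset = W ∪ (u :: L).toFinset := by
        ext w
        simp only [Finset.mem_union, Finset.mem_insert, List.toFinset_cons]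
        tauto
      rw [hU] at h
      rw [mul_left_comm]
      refine mul_le_mul_of_nonneg_left (h.trans (le_of_eq ?_)) (by positivity)
      congr 1
      refine Finset.prod_congr rfl fun j _ => ?_
      rw [freeIndicator_insert_recolor huW X hc]
      split_ifs <;> simp [hx, hQ]
    refine hstep.trans ?_
    rw [List.map_cons, List.prod_cons, ← hb]
    by_cases hu : bad u
    · rw [if_pos hu, mul_comm (2 : ℝ) b, mul_assoc]
      refine mul_le_mul_of_nonneg_left ?_ hb0
      refine (average_prod_le_two_mul _ hApos x hx1).trans (le_of_eq ?_)
      congr 1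
      refine Finset.prod_congr rfl fun j _ => ?_
      rw [List.map_cons, List.prod_cons, hbad u hu j, sub_zero, one_mul]
    · rw [if_neg hu, one_mul]
      refine mul_le_mul_of_nonneg_left ?_ hb0
      refine (average_prod_le _ hApos x (p u) hx0 hx1 (hp0 u)
        (hgood u huS hu X hX)).trans (le_of_eq ?_)
      refine Finset.prod_congr rfl fun j _ => ?_
      rw [List.map_cons, List.prod_cons]
      simp only [hx, hQ]
      ring

lemma exp_neg_le_one_sub {p : ℝ} (hp0 : 0 ≤ p) (hp : p ≤ 1 / 9) :
    Real.exp (-(9 / 8 * p)) ≤ 1 - p := by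
  rw [Real.exp_neg, inv_le_comm₀ (Real.exp_pos _) (by linarith)]
  refine le_trans ?_ (Real.add_one_le_exp _)
  rw [inv_le_iff_one_le_mul₀ (by linarith)]
  nlinarith

/-- Jensen's inequality for `exp`. -/
lemma card_mul_exp_le_sum_exp {k : ℕ} (hk : 0 < k) (s : Fin k → ℝ) {T : ℝ} (hT : ∑ j, s j ≤ T) :
    k * Real.exp (-(T / k)) ≤ ∑ j, Real.exp (-s j) := by
  have hk' : (0 : ℝ) < k := by exact_mod_cast hk
  have h : ∀ j, Real.exp (-(T / k)) * (1 - (s j - T / k)) ≤ Real.exp (-s j) := by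
    intro j
    have h1 := Real.add_one_le_exp (-(s j - T / k))
    calc Real.exp (-(T / k)) * (1 - (s j - T / k))
        ≤ Real.exp (-(T / k)) * Real.exp (-(s j - T / k)) :=
          mul_le_mul_of_nonneg_left (by linarith) (Real.exp_pos _).le
      _ = Real.exp (-s j) := by rw [← Real.exp_add]; congr 1; ring
  refine le_trans ?_ (Finset.sum_le_sum fun j _ => h j)
  rw [← Finset.mul_sum, Finset.sum_sub_distrib, Finset.sum_sub_distrib]
  simp only [Finset.sum_const, Finset.card_univ, Fintype.card_fin, nsmul_eq_mul, mul_one]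
  have : (k : ℝ) * (T / k) = T := by field_simp
  rw [this, mul_comm]
  exact mul_le_mul_of_nonneg_left (by linarith) (Real.exp_pos _).le

/-- The colors that no neighbor of `u` outside the neighborhood of `v` has. -/
def outerColors (G : SimpleGraph V) [DecidableRel G.Adj] (v : V) (f : V → Fin k) (u : V) :
    Finset (Fin k) :=
  Finset.univ \ (G.neighborFinset u \ G.neighborFinset v).image f

lemma availableColors_subset_outerColors (v : V) (f : V → Fin k) (u : V) :
    availableColors G f u ⊆ outerColors G v f u :=
  Finset.sdiff_subset_sdiff subset_rfl (Finset.image_subset_image Finset.sdiff_subset)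

lemma card_outerColors_le (v : V) (f : V → Fin k) (u : V) :
    (outerColors G v f u).card ≤ (availableColors G f u).card +
      (G.neighborFinset u ∩ G.neighborFinset v).card := by
  have h : outerColors G v f u ⊆ availableColors G f u ∪
      (G.neighborFinset u ∩ G.neighborFinset v).image f := by
    intro c hc
    simp only [outerColors, Finset.mem_sdiff, Finset.mem_univ, true_and, Finset.mem_image,
      not_exists, not_and] at hc
    by_cases h : c ∈ availableColors G f u
    · exact Finset.mem_union_left _ h
    · refine Finset.mem_union_right _ ?_
      simp only [availableColors, Finset.mem_sdiff, Finset.mem_univ, true_and, not_not] at h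
      obtain ⟨w, hw, rfl⟩ := Finset.mem_image.1 h
      refine Finset.mem_image_of_mem f (Finset.mem_inter.2 ⟨hw, ?_⟩)
      by_contra hwv
      exact hc w ⟨hw, hwv⟩ rfl
  exact (Finset.card_le_card h).trans ((Finset.card_union_le _ _).trans
    (Nat.add_le_add_left Finset.card_image_le _))

lemma outerColors_congr {v u : V} {f g : V → Fin k}
    (h : ∀ w, w ∉ G.neighborFinset v → f w = g w) :
    outerColors G v f u = outerColors G v g u := by
  unfold outerColors
  congr 1
  exact Finset.image_congr fun w hw => h w (Finset.mem_sdiff.1 hw).2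

open Classical in
/-- Resampling the neighborhood of `v` leaves few colors available for `v` only with exponentially
small probability, unless many neighbors of `v` have few outer colors to begin with. -/
lemma heatBathList_card_availableColors_lt (hk : 0 < k) {a : ℝ} (ha : 12 ≤ a) (v : V)
    (X₀ : G.Coloring (Fin k)) :
    heatBathList (G.neighborFinset v).toList
      (fun Y => if ((availableColors G Y v).card : ℝ) < a then 1 else 0) X₀ ≤
    Real.exp (a
      + ((G.neighborFinset v).filter fun u => ((outerColors G v X₀ u).card : ℝ) < a).card
      + ((G.neighborFinset v).filter fun u =>
          a / 4 < ((G.neighborFinset u ∩ G.neighborFinset v).card : ℝ)).card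
      - k * Real.exp (-(3 / 2 * G.degree v / k)) / 2) := by
  set S := G.neighborFinset v with hS
  set bad : V → Prop := fun u => ((outerColors G v X₀ u).card : ℝ) < a ∨
    a / 4 < ((G.neighborFinset u ∩ S).card : ℝ) with hbad
  set p : V → Fin k → ℝ := fun u j => if bad u then 0 else
    if j ∈ outerColors G v X₀ u then 4 / 3 / ((outerColors G v X₀ u).card : ℝ) else 0 with hp
  have hp0 : ∀ u j, 0 ≤ p u j := by
    intro u j
    simp only [hp]
    split_ifs <;> positivity
  have hp9 : ∀ u j, p u j ≤ 1 / 9 := by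
    intro u j
    simp only [hp]
    split_ifs with h1 h2
    · norm_num
    · simp only [hbad, not_or, not_lt] at h1
      rw [div_le_iff₀ (by linarith)]
      linarith
    · norm_num
  have hpsum : ∀ u, ∑ j, p u j ≤ 4 / 3 := by
    intro u
    by_cases h1 : bad u
    · simp only [hp, if_pos h1, Finset.sum_const_zero]
      norm_num
    · simp only [hp, if_neg h1]
      rw [Finset.sum_ite_mem, Finset.univ_inter, Finset.sum_const, nsmul_eq_mul]
      simp only [hbad, not_or, not_lt] at h1
      have : (0 : ℝ) < (outerColors G v X₀ u).card := by linarith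
      apply le_of_eq
      field_simp
  have hgood : ∀ u ∈ S, ¬ bad u → ∀ X : G.Coloring (Fin k), (∀ w, w ∉ S → X w = X₀ w) →
      ∀ j ∈ availableColors G X u, 1 / ((availableColors G X u).card : ℝ) ≤ p u j := by
    intro u _ hu X hX j hj
    have hO : outerColors G v X u = outerColors G v X₀ u := outerColors_congr hX
    have hj' := availableColors_subset_outerColors (G := G) v X u hj
    rw [hO] at hj'
    simp only [hp, if_neg hu, if_pos hj']
    have h1 := card_outerColors_le (G := G) v X u
    rw [hO] at h1
    have h1' : ((outerColors G v X₀ u).card : ℝ) ≤ (availableColors G X u).card +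
      (G.neighborFinset u ∩ S).card := by exact_mod_cast h1
    simp only [hbad, not_or, not_lt] at hu
    have h2 : (0 : ℝ) < (availableColors G X u).card := by
      exact_mod_cast card_availableColors_pos X u
    rw [div_le_div_iff₀ h2 (by linarith)]
    linarith
  have hmain := heatBathList_prod_le p hp0 (fun u j => (hp9 u j).trans (by norm_num)) bad
    (fun u hu j => by simp only [hp, if_pos hu]) X₀ S hgood S.toList S.nodup_toList
    (fun u hu => Finset.mem_toList.1 hu) ∅ (fun u _ => Finset.notMem_empty u) X₀ (fun _ _ => rfl)
  -- The number of available colors is compared with the potential at the end.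
  have hcmp : ∀ Y : G.Coloring (Fin k),
      (if ((availableColors G Y v).card : ℝ) < a then (1 : ℝ) else 0) ≤
      Real.exp a * ∏ j, (1 - 1 / 2 * freeIndicator (∅ ∪ S.toList.toFinset) Y j) := by
    intro Y
    have hprod : ∏ j, (1 - 1 / 2 * freeIndicator (∅ ∪ S.toList.toFinset) Y j) =
        (1 / 2 : ℝ) ^ (availableColors G Y v).card := by
      rw [Finset.empty_union, Finset.toList_toFinset, ← Finset.prod_const,
        ← Finset.prod_subset (Finset.subset_univ (availableColors G Y v))]
      · refine Finset.prod_congr rfl fun j hj => ?_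
        have : ¬ ∃ w ∈ S, Y w = j := by
          rintro ⟨w, hw, h⟩
          exact mem_availableColors.1 hj w ((G.mem_neighborFinset v w).1 hw) h
        rw [freeIndicator, if_neg this]
        norm_num
      · intro j _ hj
        have : ∃ w ∈ S, Y w = j := by
          rw [mem_availableColors] at hj
          push Not at hj
          obtain ⟨w, hw, h⟩ := hj
          exact ⟨w, (G.mem_neighborFinset v w).2 hw, h⟩
        rw [freeIndicator, if_pos this]
        norm_num
    rw [hprod]
    split_ifs with h
    · have h1 : Real.exp (-1) ≤ 1 / 2 := by
        have := Real.exp_one_gt_d9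
        rw [Real.exp_neg, inv_le_comm₀ (Real.exp_pos _) (by norm_num)]
        linarith
      calc (1 : ℝ) ≤ Real.exp (a - (availableColors G Y v).card) :=
            Real.one_le_exp (by linarith)
        _ = Real.exp a * Real.exp (-1) ^ (availableColors G Y v).card := by
            rw [← Real.exp_nat_mul, ← Real.exp_add]; congr 1; ring
        _ ≤ _ := by gcongr
    · positivity
  have hstart := heatBathList_mono S.toList hcmp X₀
  rw [heatBathList_const_mul] at hstart
  refine hstart.trans ?_
  refine (mul_le_mul_of_nonneg_left hmain (Real.exp_pos a).le).trans ?_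
  have hfac2 : (S.toList.map fun u => if bad u then (2 : ℝ) else 1).prod ≤
      Real.exp ((S.filter fun u => ((outerColors G v X₀ u).card : ℝ) < a).card
      + (S.filter fun u => a / 4 < ((G.neighborFinset u ∩ S).card : ℝ)).card) := by
    rw [Finset.prod_map_toList, Finset.card_filter, Finset.card_filter]
    push_cast
    rw [← Finset.sum_add_distrib, Real.exp_sum]
    refine Finset.prod_le_prod (fun u _ => by split_ifs <;> norm_num) fun u _ => ?_
    have he : (2 : ℝ) ≤ Real.exp 1 := by have := Real.exp_one_gt_d9; linarith
    split_ifs with h h1 h2 h3 h4 h5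
    · exact he.trans (Real.exp_le_exp.2 (by norm_num))
    · simpa using he
    · simpa using he
    · exact absurd h (by simp only [hbad]; tauto)
    all_goals exact Real.one_le_exp (by norm_num)
  have hfree : ∀ j, freeIndicator ∅ X₀ j = 1 := fun j => by simp [freeIndicator]
  have hfac3 : ∏ j, (1 - 1 / 2 * freeIndicator ∅ X₀ j * (S.toList.map fun u => 1 - p u j).prod) ≤
      Real.exp (-(k * Real.exp (-(3 / 2 * G.degree v / k)) / 2)) := by
    have hT : ∑ j, 9 / 8 * ∑ u ∈ S, p u j ≤ 3 / 2 * G.degree v := by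
      rw [← Finset.mul_sum, Finset.sum_comm]
      have := Finset.sum_le_sum fun u (_ : u ∈ S) => hpsum u
      rw [Finset.sum_const, nsmul_eq_mul, hS, SimpleGraph.card_neighborFinset_eq_degree] at this
      linarith
    have hJ := card_mul_exp_le_sum_exp hk _ hT
    calc ∏ j, (1 - 1 / 2 * freeIndicator ∅ X₀ j * (S.toList.map fun u => 1 - p u j).prod)
        ≤ ∏ j, Real.exp (-(1 / 2 * Real.exp (-(9 / 8 * ∑ u ∈ S, p u j)))) := by
          have hq : ∀ j, Real.exp (-(9 / 8 * ∑ u ∈ S, p u j)) ≤ ∏ u ∈ S, (1 - p u j) := by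
            intro j
            rw [Finset.mul_sum, ← Finset.sum_neg_distrib, Real.exp_sum]
            exact Finset.prod_le_prod (fun _ _ => (Real.exp_pos _).le)
              fun u _ => exp_neg_le_one_sub (hp0 u j) (hp9 u j)
          refine Finset.prod_le_prod (fun j _ => ?_) fun j _ => ?_
          · rw [hfree, mul_one, Finset.prod_map_toList]
            have : ∏ u ∈ S, (1 - p u j) ≤ 1 := Finset.prod_le_one
              (fun u _ => by linarith [hp9 u j]) (fun u _ => by linarith [hp0 u j])
            linarith
          · rw [hfree, mul_one, Finset.prod_map_toList]
            refine le_trans ?_ (Real.one_sub_le_exp_neg _)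
            linarith [hq j]
      _ = Real.exp (-(1 / 2 * ∑ j, Real.exp (-(9 / 8 * ∑ u ∈ S, p u j)))) := by
          rw [← Real.exp_sum, Finset.sum_neg_distrib, Finset.mul_sum]
      _ ≤ _ := Real.exp_le_exp.2 (by linarith)
  have h2nn : 0 ≤ (S.toList.map fun u => if bad u then (2 : ℝ) else 1).prod := by
    rw [Finset.prod_map_toList]
    exact Finset.prod_nonneg fun u _ => by split_ifs <;> norm_num
  calc _ ≤ Real.exp a * (Real.exp ((S.filter fun u => ((outerColors G v X₀ u).card : ℝ) < a).card
      + (S.filter fun u => a / 4 < ((G.neighborFinset u ∩ S).card : ℝ)).card) *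
        Real.exp (-(k * Real.exp (-(3 / 2 * G.degree v / k)) / 2))) := by
        refine mul_le_mul_of_nonneg_left ?_ (Real.exp_pos a).le
        refine (mul_le_mul_of_nonneg_left hfac3 h2nn).trans ?_
        exact mul_le_mul_of_nonneg_right hfac2 (Real.exp_pos _).le
    _ = _ := by
        rw [← Real.exp_add, ← Real.exp_add]
        congr 1
        ring

end Resampling

/-! ### Local uniformity of a uniformly random coloring -/

section LocalUniformity

variable {V : Type*} [Fintype V] [DecidableEq V] (G : SimpleGraph V) [DecidableRel G.Adj] (k : ℕ)

open Classical in
/-- The probability that, in a uniformly random proper `k`-coloring, fewer than `a` colors are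
available for `v`. -/
noncomputable def scarcity (a : ℝ) (v : V) : ℝ :=
  (∑ X : G.Coloring (Fin k), if ((availableColors G X v).card : ℝ) < a then (1 : ℝ) else 0) /
    Fintype.card (G.Coloring (Fin k))

omit [DecidableEq V] in
lemma scarcity_nonneg (a : ℝ) (v : V) : 0 ≤ scarcity G k a v :=
  div_nonneg (Finset.sum_nonneg fun X _ => by split_ifs <;> norm_num) (by positivity)

open Classical in
lemma card_filter_dense_neighbors_le {a : ℝ} (ha : 0 < a) (v : V) :
    (((G.neighborFinset v).filter fun u =>
      a / 4 < ((G.neighborFinset u ∩ G.neighborFinset v).card : ℝ)).card : ℝ) ≤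
    4 * graphOpNorm G * G.degree v / a := by
  have h := sum_card_neighborFinset_inter_le G (G.neighborFinset v)
  rw [SimpleGraph.card_neighborFinset_eq_degree] at h
  rw [le_div_iff₀ ha]
  have h2 : ∑ u ∈ (G.neighborFinset v).filter fun u =>
      a / 4 < ((G.neighborFinset u ∩ G.neighborFinset v).card : ℝ), a / 4 ≤
      ∑ u ∈ G.neighborFinset v, ((G.neighborFinset u ∩ G.neighborFinset v).card : ℝ) := by
    refine (Finset.sum_le_sum fun u hu => (Finset.mem_filter.1 hu).2.le).trans ?_
    exact Finset.sum_le_sum_of_subset_of_nonneg (Finset.filter_subset _ _)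
      fun _ _ _ => by positivity
  rw [Finset.sum_const, nsmul_eq_mul] at h2
  linarith

/-- Few colors are available for `v` only if this is so for many neighbors of `v`, up to an
exponentially small probability: the neighborhood of `v` may be resampled without changing the law
of the coloring, and Markov's inequality bounds the probability that `a` of the neighbors have
fewer than `a` outer colors. -/
lemma scarcity_le [Nonempty (G.Coloring (Fin k))] (hk : 0 < k) {a η : ℝ} (ha : 12 ≤ a)
    (hη : 0 ≤ η) (v : V)
    (h : Real.exp (2 * a + 4 * graphOpNorm G * G.degree v / a -
      k * Real.exp (-(3 / 2 * G.degree v / k)) / 2) ≤ η) :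
    scarcity G k a v ≤ 1 / a * ∑ u ∈ G.neighborFinset v, scarcity G k a u + η := by
  classical
  have ha0 : 0 < a := by linarith
  have hΩ : (0 : ℝ) < Fintype.card (G.Coloring (Fin k)) := by exact_mod_cast Fintype.card_pos
  set f : G.Coloring (Fin k) → ℝ := fun Y =>
    if ((availableColors G Y v).card : ℝ) < a then 1 else 0 with hf
  have hpt : ∀ X : G.Coloring (Fin k), heatBathList (G.neighborFinset v).toList f X ≤
      1 / a * (∑ u ∈ G.neighborFinset v,
        if ((availableColors G X u).card : ℝ) < a then (1 : ℝ) else 0) + η := by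
    intro X
    set F : ℝ := (((G.neighborFinset v).filter fun u =>
      ((outerColors G v X u).card : ℝ) < a).card : ℝ) with hF
    have hFle : F ≤ ∑ u ∈ G.neighborFinset v,
        if ((availableColors G X u).card : ℝ) < a then (1 : ℝ) else 0 := by
      rw [hF, Finset.card_filter]
      push_cast
      refine Finset.sum_le_sum fun u _ => ?_
      split_ifs with h1 h2
      · exact le_rfl
      · refine absurd (lt_of_le_of_lt ?_ h1) h2
        exact_mod_cast Finset.card_le_card (availableColors_subset_outerColors (G := G) v X u)
      · norm_num
      · exact le_rfl
    have hFle' : F / a ≤ 1 / a * ∑ u ∈ G.neighborFinset v,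
        if ((availableColors G X u).card : ℝ) < a then (1 : ℝ) else 0 := by
      rw [div_eq_mul_inv, mul_comm, one_div]
      exact mul_le_mul_of_nonneg_left hFle (by positivity)
    by_cases hFa : F < a
    · have h1 := heatBathList_card_availableColors_lt hk ha v X
      have h2 : heatBathList (G.neighborFinset v).toList f X ≤ η := by
        refine h1.trans (le_trans (Real.exp_le_exp.2 ?_) h)
        have := card_filter_dense_neighbors_le G ha0 v
        linarith
      have h3 : 0 ≤ F / a := by positivity
      linarith
    · have h1 : heatBathList (G.neighborFinset v).toList f X ≤ 1 := by
        have := heatBathList_mono (G.neighborFinset v).toList (f := f) (g := fun _ => (1 : ℝ))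
          (fun Y => by simp only [hf]; split_ifs <;> norm_num) X
        rwa [heatBathList_const] at this
      have h3 : 1 ≤ F / a := by rw [le_div_iff₀ ha0]; linarith
      linarith
  have hsum := Finset.sum_le_sum fun X (_ : X ∈ Finset.univ) => hpt X
  rw [sum_heatBathList, Finset.sum_add_distrib, ← Finset.mul_sum, Finset.sum_comm,
    Finset.sum_const, nsmul_eq_mul, Finset.card_univ] at hsum
  simp only [scarcity]
  rw [div_le_iff₀ hΩ, ← Finset.sum_div, add_mul, mul_assoc, div_mul_cancel₀ _ hΩ.ne', mul_comm η]
  exact hsum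

lemma l2norm_scarcity_le [Nonempty (G.Coloring (Fin k))] (hk : 0 < k) {a η : ℝ} (ha : 12 ≤ a)
    (hη : 0 ≤ η) (hρ : 2 * graphOpNorm G ≤ a)
    (h : ∀ v, Real.exp (2 * a + 4 * graphOpNorm G * G.degree v / a -
      k * Real.exp (-(3 / 2 * G.degree v / k)) / 2) ≤ η) :
    l2norm (scarcity G k a) ≤ 2 * η * √(Fintype.card V) := by
  have ha0 : 0 < a := by linarith
  have h1 := l2norm_mono (scarcity_nonneg G k a) fun v => scarcity_le G k hk ha hη v (h v)
  have h2 := l2norm_add_le (fun v => 1 / a * ∑ u ∈ G.neighborFinset v, scarcity G k a u)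
    (fun _ => η)
  rw [l2norm_const_mul _ (by positivity), l2norm_const _ hη] at h2
  have h3 := l2norm_neighbor_sum_le G (scarcity G k a)
  have h4 : 1 / a * l2norm (fun v => ∑ u ∈ G.neighborFinset v, scarcity G k a u) ≤
      1 / 2 * l2norm (scarcity G k a) := by
    rw [one_div, inv_mul_le_iff₀ ha0]
    have := l2norm_nonneg (scarcity G k a)
    nlinarith
  linarith

end LocalUniformity

/-! ### The coupling -/

section MaximalCoupling

variable {α : Type*} [Fintype α] [DecidableEq α]

omit [DecidableEq α] in
lemma sum_max_sub_eq (μ ν : α → ℝ) (h : ∑ c, μ c = ∑ c, ν c) :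
    ∑ c, max (ν c - μ c) 0 = ∑ c, max (μ c - ν c) 0 := by
  have : ∀ c, max (ν c - μ c) 0 = max (μ c - ν c) 0 + (ν c - μ c) := by
    intro c
    rcases le_total (μ c) (ν c) with hc | hc
    · rw [max_eq_left (by linarith), max_eq_right (by linarith)]; ring
    · rw [max_eq_right (by linarith), max_eq_left (by linarith)]; ring
  rw [Finset.sum_congr rfl fun c _ => this c, Finset.sum_add_distrib, Finset.sum_sub_distrib, h]
  ring

/-- The maximal coupling of two probability vectors. -/
lemma exists_maximal_coupling (μ ν : α → ℝ) (hμ : ∀ c, 0 ≤ μ c) (hν : ∀ c, 0 ≤ ν c)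
    (h : ∑ c, μ c = ∑ c, ν c) :
    ∃ w : α → α → ℝ, (∀ c d, 0 ≤ w c d) ∧ (∀ c, ∑ d, w c d = μ c) ∧ (∀ d, ∑ c, w c d = ν d) ∧
      ∑ c, ∑ d, w c d * (if c = d then 0 else 1) ≤ ∑ c, max (μ c - ν c) 0 := by
  set P : α → ℝ := fun c => max (μ c - ν c) 0 with hP
  set N : α → ℝ := fun c => max (ν c - μ c) 0 with hN
  set D := ∑ c, P c with hD
  have hND : ∑ c, N c = D := sum_max_sub_eq μ ν h
  have hP0 : ∀ c, 0 ≤ P c := fun c => le_max_right _ _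
  have hN0 : ∀ c, 0 ≤ N c := fun c => le_max_right _ _
  have hD0 : 0 ≤ D := Finset.sum_nonneg fun c _ => hP0 c
  -- If `D = 0`, then `P` and `N` vanish, and the junk value of the division is the right one.
  have hPD : ∀ c, P c * D / D = P c := by
    intro c
    by_cases hD' : D = 0
    · have := (Finset.sum_eq_zero_iff_of_nonneg fun c _ => hP0 c).1 (hD ▸ hD') c (by simp)
      simp [this]
    · field_simp
  have hDN : ∀ c, D * N c / D = N c := by
    intro c
    by_cases hD' : D = 0
    · have := (Finset.sum_eq_zero_iff_of_nonneg fun c _ => hN0 c).1 (hND.trans hD') c (by simp)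
      simp [this]
    · field_simp
  refine ⟨fun c d => (if c = d then min (μ c) (ν c) else 0) + P c * N d / D, ?_, ?_, ?_, ?_⟩
  · intro c d
    have h1 := hP0 c
    have h2 := hN0 d
    have h3 := le_min (hμ c) (hν c)
    dsimp only
    split_ifs <;> positivity
  · intro c
    rw [Finset.sum_add_distrib, Finset.sum_ite_eq, if_pos (Finset.mem_univ c), ← Finset.sum_div,
      ← Finset.mul_sum, hND, hPD]
    simp only [hP]
    rcases le_total (μ c) (ν c) with hc | hc
    · rw [min_eq_left hc, max_eq_right (by linarith)]; ring
    · rw [min_eq_right hc, max_eq_left (by linarith)]; ring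
  · intro d
    rw [Finset.sum_add_distrib, Finset.sum_ite_eq', if_pos (Finset.mem_univ d), ← Finset.sum_div,
      ← Finset.sum_mul, ← hD, hDN]
    simp only [hN]
    rcases le_total (μ d) (ν d) with hc | hc
    · rw [min_eq_left hc, max_eq_left (by linarith)]; ring
    · rw [min_eq_right hc, max_eq_right (by linarith)]; ring
  · have : ∑ c, ∑ d, P c * N d / D = D := by
      calc ∑ c, ∑ d, P c * N d / D = ∑ c, P c := by
            refine Finset.sum_congr rfl fun c _ => ?_
            rw [← Finset.sum_div, ← Finset.mul_sum, hND, hPD]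
        _ = D := rfl
    refine le_trans (Finset.sum_le_sum fun c _ => Finset.sum_le_sum fun d _ => ?_) this.le
    have h1 := hP0 c
    have h2 := hN0 d
    have h3 : 0 ≤ P c * N d / D := by positivity
    dsimp only
    by_cases hcd : c = d
    · rw [if_pos hcd, if_pos hcd, mul_zero]
      exact h3
    · simp [hcd]

/-- The uniform probability vector on a subset. -/
noncomputable def uniformOn (A : Finset α) (c : α) : ℝ := if c ∈ A then 1 / (A.card : ℝ) else 0

omit [Fintype α] in
lemma uniformOn_nonneg (A : Finset α) (c : α) : 0 ≤ uniformOn A c := by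
  unfold uniformOn; split_ifs <;> positivity

lemma sum_uniformOn {A : Finset α} (hA : 0 < A.card) : ∑ c, uniformOn A c = 1 := by
  simp only [uniformOn]
  rw [Finset.sum_ite_mem, Finset.univ_inter, Finset.sum_const, nsmul_eq_mul]
  field_simp

lemma sum_max_uniformOn_sub_le_of_card_le {A B : Finset α} (hB : 0 < B.card)
    (hBA : B.card ≤ A.card) :
    ∑ c, max (uniformOn A c - uniformOn B c) 0 ≤ ((A \ B).card : ℝ) / A.card := by
  have h : ∀ c, max (uniformOn A c - uniformOn B c) 0 ≤
      if c ∈ A \ B then 1 / (A.card : ℝ) else 0 := by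
    intro c
    simp only [uniformOn, Finset.mem_sdiff]
    by_cases hcA : c ∈ A <;> by_cases hcB : c ∈ B
    · simp only [hcA, hcB, if_true, not_true_eq_false, and_false, if_false]
      refine max_le ?_ le_rfl
      rw [sub_nonpos]
      exact one_div_le_one_div_of_le (by exact_mod_cast hB) (by exact_mod_cast hBA)
    · simp [hcA, hcB]
    · simp [hcA, hcB]
    · simp [hcA, hcB]
  refine (Finset.sum_le_sum fun c _ => h c).trans (le_of_eq ?_)
  rw [Finset.sum_ite_mem, Finset.univ_inter, Finset.sum_const, nsmul_eq_mul]
  ring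

/-- Only the size of one of the two sets has to be bounded from below. -/
lemma sum_max_uniformOn_sub_le {A B : Finset α} (hA : 0 < A.card) (hB : 0 < B.card) {a D : ℝ}
    (ha : 0 < a) (haA : a ≤ A.card) (hAB : ((A \ B).card : ℝ) ≤ D)
    (hBA : ((B \ A).card : ℝ) ≤ D) :
    ∑ c, max (uniformOn A c - uniformOn B c) 0 ≤ D / a := by
  have hD : 0 ≤ D := le_trans (by positivity) hAB
  rcases le_total B.card A.card with hle | hle
  · exact (sum_max_uniformOn_sub_le_of_card_le hB hle).trans
      (div_le_div₀ hD hAB ha haA)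
  · rw [sum_max_sub_eq _ _ ((sum_uniformOn hB).trans (sum_uniformOn hA).symm)]
    refine (sum_max_uniformOn_sub_le_of_card_le hA hle).trans
      (div_le_div₀ hD hBA ha (haA.trans ?_))
    exact_mod_cast hle

end MaximalCoupling

section Coupling

variable {V : Type*} [Fintype V] [DecidableEq V] {G : SimpleGraph V} [DecidableRel G.Adj] {k : ℕ}

/-- `1` if the colorings `X` and `Y` differ at `v`, and `0` otherwise. -/
def disagree (X Y : V → Fin k) (v : V) : ℝ := if X v = Y v then 0 else 1

omit [Fintype V] [DecidableEq V] in
lemma disagree_nonneg (X Y : V → Fin k) (v : V) : 0 ≤ disagree X Y v := by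
  unfold disagree; split_ifs <;> norm_num

omit [DecidableEq V] in
lemma card_availableColors_sdiff_le (X Y : V → Fin k) (v : V) :
    ((availableColors G X v \ availableColors G Y v).card : ℝ) ≤
      ∑ w ∈ G.neighborFinset v, disagree X Y w := by
  have h : availableColors G X v \ availableColors G Y v ⊆
      ((G.neighborFinset v).filter fun w => ¬ X w = Y w).image Y := by
    intro c hc
    rw [Finset.mem_sdiff, mem_availableColors, mem_availableColors] at hc
    obtain ⟨h1, h2⟩ := hc
    push Not at h2
    obtain ⟨w, hw, rfl⟩ := h2
    exact Finset.mem_image_of_mem Y (Finset.mem_filter.2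
      ⟨(G.mem_neighborFinset v w).2 hw, h1 w hw⟩)
  have h2 := (Finset.card_le_card h).trans Finset.card_image_le
  have h3 : ∑ w ∈ G.neighborFinset v, disagree X Y w =
      (((G.neighborFinset v).filter fun w => ¬ X w = Y w).card : ℝ) := by
    rw [Finset.card_filter]
    push_cast
    refine Finset.sum_congr rfl fun w _ => ?_
    unfold disagree
    by_cases hw : X w = Y w <;> simp [hw]
  rw [h3]
  exact_mod_cast h2

omit [Fintype V] [DecidableEq V] in
lemma disagree_comm (X Y : V → Fin k) : disagree X Y = disagree Y X := by
  ext w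
  unfold disagree
  simp only [eq_comm]

omit [DecidableEq V] in
/-- The colors chosen at `v` in the two chains can be coupled so that they differ with small
probability, if many colors are available for `v` in the first chain. -/
lemma exists_color_coupling (X Y : G.Coloring (Fin k)) {a : ℝ} (ha : 0 < a) (v : V) :
    ∃ w : Fin k → Fin k → ℝ, (∀ c d, 0 ≤ w c d) ∧
      (∀ c, ∑ d, w c d = uniformOn (availableColors G X v) c) ∧
      (∀ d, ∑ c, w c d = uniformOn (availableColors G Y v) d) ∧
      ∑ c, ∑ d, w c d * (if c = d then 0 else 1) ≤
        (if ((availableColors G X v).card : ℝ) < a then (1 : ℝ) else 0) +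
          1 / a * ∑ u ∈ G.neighborFinset v, disagree X Y u := by
  have hA := card_availableColors_pos X v
  have hB := card_availableColors_pos Y v
  obtain ⟨w, hw0, hwX, hwY, hw⟩ := exists_maximal_coupling
    (uniformOn (availableColors G X v)) (uniformOn (availableColors G Y v))
    (uniformOn_nonneg _) (uniformOn_nonneg _) ((sum_uniformOn hA).trans (sum_uniformOn hB).symm)
  have hD : 0 ≤ 1 / a * ∑ u ∈ G.neighborFinset v, disagree X Y u :=
    mul_nonneg (by positivity) (Finset.sum_nonneg fun u _ => disagree_nonneg X Y u)
  refine ⟨w, hw0, hwX, hwY, hw.trans ?_⟩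
  split_ifs with h
  · have : ∑ c, max (uniformOn (availableColors G X v) c -
        uniformOn (availableColors G Y v) c) 0 ≤ 1 := by
      rw [← sum_uniformOn hA]
      exact Finset.sum_le_sum fun c _ => max_le
        (by linarith [uniformOn_nonneg (availableColors G Y v) c]) (uniformOn_nonneg _ c)
    linarith
  · have h1 := sum_max_uniformOn_sub_le hA hB ha (not_lt.1 h)
      (card_availableColors_sdiff_le (G := G) X Y v)
      (by rw [disagree_comm]; exact card_availableColors_sdiff_le (G := G) Y X v)
    rw [zero_add, one_div, inv_mul_eq_div]
    exact h1

lemma sum_uniformOn_mul (X : G.Coloring (Fin k)) (X' : G.Coloring (Fin k)) :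
    ∑ u : V, (1 / (Fintype.card V : ℝ)) * ∑ c, uniformOn (availableColors G X u) c *
      (if recolor X u c = X' then 1 else 0) = glauberMatrix G k X X' := by
  rw [glauberMatrix_apply]
  refine Finset.sum_congr rfl fun u _ => ?_
  congr 1
  simp only [uniformOn, ite_mul, zero_mul]
  rw [Finset.sum_ite_mem, Finset.univ_inter]

/-- One step of the coupling: both chains update the same vertex, with coupled colors. -/
lemma exists_step_coupling (X Y : G.Coloring (Fin k)) {a : ℝ} (ha : 0 < a)
    (hV : 0 < Fintype.card V) :
    ∃ q : G.Coloring (Fin k) → G.Coloring (Fin k) → ℝ, (∀ X' Y', 0 ≤ q X' Y') ∧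
      (∀ X', ∑ Y', q X' Y' = glauberMatrix G k X X') ∧
      (∀ Y', ∑ X', q X' Y' = glauberMatrix G k Y Y') ∧
      ∀ v, ∑ X', ∑ Y', q X' Y' * disagree X' Y' v ≤
        (1 - 1 / (Fintype.card V : ℝ)) * disagree X Y v + 1 / (Fintype.card V : ℝ) *
          ((if ((availableColors G X v).card : ℝ) < a then (1 : ℝ) else 0) +
            1 / a * ∑ u ∈ G.neighborFinset v, disagree X Y u) := by
  choose w hw0 hwX hwY hw using exists_color_coupling X Y ha
  have hn : (0 : ℝ) < Fintype.card V := by exact_mod_cast hV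
  refine ⟨fun X' Y' => ∑ u, (1 / (Fintype.card V : ℝ)) * ∑ c, ∑ d, w u c d *
    ((if recolor X u c = X' then 1 else 0) * (if recolor Y u d = Y' then 1 else 0)),
    ?_, ?_, ?_, ?_⟩
  · intro X' Y'
    refine Finset.sum_nonneg fun u _ => mul_nonneg (by positivity) ?_
    refine Finset.sum_nonneg fun c _ => Finset.sum_nonneg fun d _ => mul_nonneg (hw0 u c d) ?_
    split_ifs <;> norm_num
  · intro X'
    rw [Finset.sum_comm, ← sum_uniformOn_mul]
    refine Finset.sum_congr rfl fun u _ => ?_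
    rw [← Finset.mul_sum, Finset.sum_comm]
    congr 1
    refine Finset.sum_congr rfl fun c _ => ?_
    rw [Finset.sum_comm, ← hwX u c, Finset.sum_mul]
    refine Finset.sum_congr rfl fun d _ => ?_
    rw [← Finset.mul_sum, ← Finset.mul_sum]
    simp
  · intro Y'
    rw [Finset.sum_comm, ← sum_uniformOn_mul]
    refine Finset.sum_congr rfl fun u _ => ?_
    rw [← Finset.mul_sum, Finset.sum_comm]
    congr 1
    simp_rw [fun c => Finset.sum_comm (s := Finset.univ (α := G.Coloring (Fin k)))
      (t := Finset.univ (α := Fin k)) (f := fun X' d => w u c d *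
        ((if recolor X u c = X' then (1 : ℝ) else 0) * (if recolor Y u d = Y' then 1 else 0)))]
    rw [Finset.sum_comm]
    refine Finset.sum_congr rfl fun d _ => ?_
    rw [← hwY u d, Finset.sum_mul]
    refine Finset.sum_congr rfl fun c _ => ?_
    rw [← Finset.mul_sum, ← Finset.sum_mul]
    simp
  · intro v
    have hexp : ∑ X' : G.Coloring (Fin k), ∑ Y' : G.Coloring (Fin k),
        (∑ u, (1 / (Fintype.card V : ℝ)) * ∑ c, ∑ d, w u c d *
          ((if recolor X u c = X' then 1 else 0) * (if recolor Y u d = Y' then 1 else 0))) *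
            disagree X' Y' v =
        ∑ u, (1 / (Fintype.card V : ℝ)) * ∑ c, ∑ d, w u c d *
          disagree (recolor X u c) (recolor Y u d) v := by
      have hpt : ∀ u c d, w u c d * disagree (recolor X u c) (recolor Y u d) v =
          ∑ X' : G.Coloring (Fin k), ∑ Y' : G.Coloring (Fin k), w u c d *
          ((if recolor X u c = X' then 1 else 0) * (if recolor Y u d = Y' then 1 else 0)) *
            disagree X' Y' v := by
        intro u c d
        rw [Finset.sum_eq_single (recolor X u c), Finset.sum_eq_single (recolor Y u d)]
        · simp
        · intro Y' _ hY'
          simp [hY'.symm]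
        · simp
        · intro X' _ hX'
          simp [hX'.symm]
        · simp
      simp_rw [hpt, Finset.sum_mul, Finset.mul_sum, Finset.sum_mul]
      rw [Finset.sum_congr rfl fun X' _ => Finset.sum_comm, Finset.sum_comm]
      refine Finset.sum_congr rfl fun u _ => ?_
      rw [Finset.sum_congr rfl fun X' _ => Finset.sum_comm, Finset.sum_comm]
      refine Finset.sum_congr rfl fun c _ => ?_
      rw [Finset.sum_congr rfl fun X' _ => Finset.sum_comm, Finset.sum_comm]
      refine Finset.sum_congr rfl fun d _ => Finset.sum_congr rfl fun X' _ =>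
        Finset.sum_congr rfl fun Y' _ => by ring
    rw [hexp]
    have hne : ∀ u, u ≠ v → ∑ c, ∑ d, w u c d * disagree (recolor X u c) (recolor Y u d) v =
        disagree X Y v := by
      intro u hu
      have : ∀ c d, disagree (recolor X u c) (recolor Y u d) v = disagree X Y v := by
        intro c d
        unfold disagree
        rw [recolor_of_ne X c hu.symm, recolor_of_ne Y d hu.symm]
      simp_rw [this, ← Finset.sum_mul, hwX u, sum_uniformOn (card_availableColors_pos X u),
        one_mul]
    have heq : ∑ c, ∑ d, w v c d * disagree (recolor X v c) (recolor Y v d) v ≤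
        (if ((availableColors G X v).card : ℝ) < a then (1 : ℝ) else 0) +
          1 / a * ∑ u ∈ G.neighborFinset v, disagree X Y u := by
      refine le_trans (le_of_eq ?_) (hw v)
      refine Finset.sum_congr rfl fun c _ => Finset.sum_congr rfl fun d _ => ?_
      by_cases hc : c ∈ availableColors G X v
      · by_cases hd : d ∈ availableColors G Y v
        · unfold disagree
          rw [recolor_self hc, recolor_self hd]
        · have h0 : ∑ c, w v c d = 0 := by rw [hwY v d, uniformOn, if_neg hd]
          rw [(Finset.sum_eq_zero_iff_of_nonneg fun c _ => hw0 v c d).1 h0 c (by simp), zero_mul,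
            zero_mul]
      · have h0 : ∑ d, w v c d = 0 := by rw [hwX v c, uniformOn, if_neg hc]
        rw [(Finset.sum_eq_zero_iff_of_nonneg fun d _ => hw0 v c d).1 h0 d (by simp), zero_mul,
          zero_mul]
    rw [← Finset.add_sum_erase _ _ (Finset.mem_univ v), add_comm]
    refine add_le_add (le_of_eq ?_) (mul_le_mul_of_nonneg_left heq (by positivity))
    rw [Finset.sum_congr rfl fun u hu => by rw [hne u (Finset.ne_of_mem_erase hu)],
      Finset.sum_const, Finset.card_erase_of_mem (Finset.mem_univ v), nsmul_eq_mul,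
      Finset.card_univ, Nat.cast_sub hV]
    push_cast
    field_simp

/-- The chain started in `y` is coupled with a stationary chain; the Euclidean norm of the vector
of disagreement probabilities decays up to an error from the scarcity of available colors, which
is only needed for the stationary chain. -/
lemma exists_coupling [Nonempty (G.Coloring (Fin k))] {a : ℝ} (ha : 0 < a)
    (hρ : 2 * graphOpNorm G ≤ a) (hV : 0 < Fintype.card V) (y : G.Coloring (Fin k)) (t : ℕ) :
    ∃ ν : G.Coloring (Fin k) → G.Coloring (Fin k) → ℝ, (∀ X Y, 0 ≤ ν X Y) ∧
      (∀ X, ∑ Y, ν X Y = 1 / Fintype.card (G.Coloring (Fin k))) ∧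
      (∀ Y, ∑ X, ν X Y = (glauberMatrix G k ^ t) y Y) ∧
      l2norm (fun v => ∑ X, ∑ Y, ν X Y * disagree X Y v) ≤
        (1 - 1 / (2 * (Fintype.card V : ℝ))) ^ t * √(Fintype.card V) +
          2 * l2norm (scarcity G k a) := by
  have hn : (1 : ℝ) ≤ Fintype.card V := by exact_mod_cast hV
  have hΩ : (0 : ℝ) < Fintype.card (G.Coloring (Fin k)) := by exact_mod_cast Fintype.card_pos
  have hδ := l2norm_nonneg (scarcity G k a)
  induction t with
  | zero =>
    refine ⟨fun X Y => if y = Y then 1 / Fintype.card (G.Coloring (Fin k)) else 0, ?_, ?_, ?_, ?_⟩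
    · intro X Y
      dsimp only
      split_ifs <;> positivity
    · intro X
      simp
    · intro Y
      rw [pow_zero, Matrix.one_apply, Finset.sum_const, nsmul_eq_mul, Finset.card_univ]
      split_ifs
      · field_simp
      · simp
    · rw [pow_zero, one_mul]
      have h1 : l2norm (fun v : V => ∑ X : G.Coloring (Fin k), ∑ Y : G.Coloring (Fin k),
          (if y = Y then 1 / (Fintype.card (G.Coloring (Fin k)) : ℝ) else 0) *
            disagree X Y v) ≤ l2norm (fun _ : V => (1 : ℝ)) := by
        refine l2norm_mono (fun v => ?_) fun v => ?_
        · refine Finset.sum_nonneg fun X _ => Finset.sum_nonneg fun Y _ =>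
            mul_nonneg ?_ (disagree_nonneg X Y v)
          split_ifs <;> positivity
        · have h2 : ∀ X : G.Coloring (Fin k), ∑ Y : G.Coloring (Fin k),
              (if y = Y then 1 / (Fintype.card (G.Coloring (Fin k)) : ℝ) else 0) *
                disagree X Y v ≤ 1 / (Fintype.card (G.Coloring (Fin k)) : ℝ) := by
            intro X
            simp only [ite_mul, zero_mul, Finset.sum_ite_eq, Finset.mem_univ, if_true]
            refine mul_le_of_le_one_right (by positivity) ?_
            unfold disagree
            split_ifs <;> norm_num
          refine (Finset.sum_le_sum fun X _ => h2 X).trans (le_of_eq ?_)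
          rw [Finset.sum_const, nsmul_eq_mul, Finset.card_univ]
          field_simp
      rw [l2norm_const _ zero_le_one, mul_one] at h1
      linarith
  | succ t ih =>
    obtain ⟨ν, hν0, hνX, hνY, hν⟩ := ih
    choose q hq0 hqX hqY hq using fun X Y : G.Coloring (Fin k) =>
      exists_step_coupling X Y ha hV
    refine ⟨fun X' Y' => ∑ X, ∑ Y, ν X Y * q X Y X' Y', ?_, ?_, ?_, ?_⟩
    · intro X' Y'
      exact Finset.sum_nonneg fun X _ => Finset.sum_nonneg fun Y _ =>
        mul_nonneg (hν0 X Y) (hq0 X Y X' Y')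
    · intro X'
      have h1 : ∀ X, ∑ Y', ∑ Y, ν X Y * q X Y X' Y' =
          1 / Fintype.card (G.Coloring (Fin k)) * glauberMatrix G k X X' := by
        intro X
        rw [Finset.sum_comm, ← hνX X, Finset.sum_mul]
        refine Finset.sum_congr rfl fun Y _ => ?_
        rw [← Finset.mul_sum, hqX]
      rw [Finset.sum_comm, Finset.sum_congr rfl fun X _ => h1 X, ← Finset.mul_sum,
        sum_glauberMatrix_left hV, mul_one]
    · intro Y'
      have h1 : ∀ Y, ∑ X, ∑ X', ν X Y * q X Y X' Y' =
          (glauberMatrix G k ^ t) y Y * glauberMatrix G k Y Y' := by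
        intro Y
        rw [← hνY Y, Finset.sum_mul]
        refine Finset.sum_congr rfl fun X _ => ?_
        rw [← Finset.mul_sum, hqY]
      rw [pow_succ, Matrix.mul_apply, Finset.sum_comm,
        ← Finset.sum_congr rfl fun Y _ => h1 Y, Finset.sum_comm (s := Finset.univ) (t := Finset.univ)
          (f := fun Y X => ∑ X', ν X Y * q X Y X' Y')]
      refine Finset.sum_congr rfl fun X _ => Finset.sum_comm
    · set n : ℝ := (Fintype.card V : ℝ) with hnn
      set m : V → ℝ := fun v => ∑ X, ∑ Y, ν X Y * disagree X Y v with hm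
      have hstep : ∀ v, ∑ X', ∑ Y', (∑ X, ∑ Y, ν X Y * q X Y X' Y') * disagree X' Y' v ≤
          (1 - 1 / n) * m v + (1 / n * scarcity G k a v +
            1 / n * (1 / a * ∑ u ∈ G.neighborFinset v, m u)) := by
        intro v
        have h1 : ∑ X', ∑ Y', (∑ X, ∑ Y, ν X Y * q X Y X' Y') * disagree X' Y' v =
            ∑ X, ∑ Y, ν X Y * ∑ X', ∑ Y', q X Y X' Y' * disagree X' Y' v := by
          simp_rw [Finset.sum_mul, Finset.mul_sum]
          rw [Finset.sum_congr rfl fun X' _ => Finset.sum_comm, Finset.sum_comm]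
          refine Finset.sum_congr rfl fun X _ => ?_
          rw [Finset.sum_congr rfl fun X' _ => Finset.sum_comm, Finset.sum_comm]
          refine Finset.sum_congr rfl fun Y _ => Finset.sum_congr rfl fun X' _ =>
            Finset.sum_congr rfl fun Y' _ => by ring
        have h2 : ∑ X, ∑ Y, ν X Y *
            (if ((availableColors G X v).card : ℝ) < a then (1 : ℝ) else 0) =
            scarcity G k a v := by
          simp_rw [← Finset.sum_mul, hνX, scarcity, ← Finset.mul_sum]
          rw [one_div, inv_mul_eq_div]
        have h3 : ∑ u ∈ G.neighborFinset v, m u =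
            ∑ X, ∑ Y, ν X Y * ∑ u ∈ G.neighborFinset v, disagree X Y u := by
          simp_rw [hm, Finset.mul_sum]
          rw [Finset.sum_comm]
          exact Finset.sum_congr rfl fun X _ => Finset.sum_comm
        rw [h1, ← h2, h3]
        refine (Finset.sum_le_sum fun X _ => Finset.sum_le_sum fun Y _ =>
          mul_le_mul_of_nonneg_left (hq X Y v) (hν0 X Y)).trans (le_of_eq ?_)
        simp only [hm, Finset.mul_sum (s := Finset.univ (α := G.Coloring (Fin k))),
          ← Finset.sum_add_distrib]
        exact Finset.sum_congr rfl fun X _ => Finset.sum_congr rfl fun Y _ => by ring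
      have hle : 0 ≤ 1 - 1 / n := by
        rw [sub_nonneg, div_le_one (by linarith)]; exact hn
      have h1 := l2norm_mono (fun v => Finset.sum_nonneg fun X' _ => Finset.sum_nonneg fun Y' _ =>
        mul_nonneg (Finset.sum_nonneg fun X _ => Finset.sum_nonneg fun Y _ =>
          mul_nonneg (hν0 X Y) (hq0 X Y X' Y')) (disagree_nonneg X' Y' v)) hstep
      have h2 := l2norm_add_le (fun v => (1 - 1 / n) * m v) (fun v => 1 / n * scarcity G k a v +
            1 / n * (1 / a * ∑ u ∈ G.neighborFinset v, m u))
      have h3 := l2norm_add_le (fun v => 1 / n * scarcity G k a v)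
        (fun v => 1 / n * (1 / a * ∑ u ∈ G.neighborFinset v, m u))
      rw [l2norm_const_mul _ (by positivity), l2norm_const_mul _ (by positivity),
        l2norm_const_mul _ (by positivity)] at h3
      rw [l2norm_const_mul _ hle] at h2
      have h4 : 1 / a * l2norm (fun v => ∑ u ∈ G.neighborFinset v, m u) ≤ 1 / 2 * l2norm m := by
        have := l2norm_neighbor_sum_le G m
        have := l2norm_nonneg m
        rw [one_div, inv_mul_le_iff₀ ha]
        nlinarith
      have h5 := mul_le_mul_of_nonneg_left h4 (show 0 ≤ 1 / n by positivity)
      have hle2 : 0 ≤ 1 - 1 / (2 * n) := by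
        rw [sub_nonneg, div_le_one (by linarith)]; linarith
      have h6 := mul_le_mul_of_nonneg_left hν hle2
      have e1 : (1 - 1 / (2 * n)) * l2norm m =
          (1 - 1 / n) * l2norm m + 1 / n * (1 / 2 * l2norm m) := by
        field_simp; ring
      have e2 : (1 - 1 / (2 * n)) * ((1 - 1 / (2 * n)) ^ t * √n + 2 * l2norm (scarcity G k a)) =
          (1 - 1 / (2 * n)) ^ (t + 1) * √n + 2 * l2norm (scarcity G k a) -
            1 / n * l2norm (scarcity G k a) := by
        rw [pow_succ]
        generalize (1 - 1 / (2 * n)) ^ t = b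
        field_simp
        ring
      linarith

omit [DecidableEq V] [DecidableRel G.Adj] in
/-- The coupling inequality, with a union bound over the vertices. -/
lemma tvDist_le_sum_disagree (ν : G.Coloring (Fin k) → G.Coloring (Fin k) → ℝ)
    (hν0 : ∀ X Y, 0 ≤ ν X Y) (μ π : G.Coloring (Fin k) → ℝ) (hπ : ∀ X, ∑ Y, ν X Y = π X)
    (hμ : ∀ Y, ∑ X, ν X Y = μ Y) :
    tvDist μ π ≤ ∑ v, ∑ X, ∑ Y, ν X Y * disagree X Y v := by
  set e : G.Coloring (Fin k) → G.Coloring (Fin k) → ℝ := fun X Y => ∑ v, disagree X Y v with he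
  have he1 : ∀ X Y, X ≠ Y → 1 ≤ e X Y := by
    intro X Y hXY
    obtain ⟨v, hv⟩ := DFunLike.ne_iff.1 hXY
    have : disagree X Y v = 1 := by rw [disagree, if_neg hv]
    rw [← this]
    exact Finset.single_le_sum (f := fun v => disagree X Y v)
      (fun w _ => disagree_nonneg X Y w) (Finset.mem_univ v)
  have he0 : ∀ X Y, 0 ≤ e X Y := fun X Y => Finset.sum_nonneg fun v _ => disagree_nonneg X Y v
  have hs : ∀ s, |μ s - π s| ≤ ∑ X, ν X s * e X s + ∑ Y, ν s Y * e s Y := by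
    intro s
    have h1 : μ s - π s = ∑ X, (ν X s - ν s X) := by
      rw [← hμ, ← hπ, Finset.sum_sub_distrib]
    rw [h1, ← Finset.sum_add_distrib]
    refine (Finset.abs_sum_le_sum_abs _ _).trans (Finset.sum_le_sum fun X _ => ?_)
    by_cases hX : X = s
    · subst hX
      rw [sub_self, abs_zero]
      exact add_nonneg (mul_nonneg (hν0 _ _) (he0 _ _)) (mul_nonneg (hν0 _ _) (he0 _ _))
    · have h2 := hν0 X s
      have h3 := hν0 s X
      have h4 := he1 X s hX
      have h5 := he1 s X (Ne.symm hX)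
      rw [abs_le]
      constructor <;> nlinarith
  have h1 := Finset.sum_le_sum fun s (_ : s ∈ Finset.univ) => hs s
  rw [Finset.sum_add_distrib, Finset.sum_comm] at h1
  have h2 : ∑ v, ∑ X, ∑ Y, ν X Y * disagree X Y v = ∑ X, ∑ Y, ν X Y * e X Y := by
    simp_rw [he, Finset.mul_sum]
    rw [Finset.sum_comm]
    exact Finset.sum_congr rfl fun X _ => Finset.sum_comm
  rw [h2, tvDist]
  linarith

lemma tvDist_glauberMatrix_pow_le [Nonempty (G.Coloring (Fin k))] (hk : 0 < k) {a η : ℝ}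
    (ha : 12 ≤ a) (hη : 0 ≤ η) (hρ : 2 * graphOpNorm G ≤ a) (hV : 0 < Fintype.card V)
    (h : ∀ v, Real.exp (2 * a + 4 * graphOpNorm G * G.degree v / a -
      k * Real.exp (-(3 / 2 * G.degree v / k)) / 2) ≤ η) (y : G.Coloring (Fin k)) (t : ℕ) :
    tvDist ((glauberMatrix G k ^ t) y) (uniformDist (G.Coloring (Fin k))) ≤
      Fintype.card V * ((1 - 1 / (2 * (Fintype.card V : ℝ))) ^ t + 4 * η) := by
  obtain ⟨ν, hν0, hνX, hνY, hν⟩ := exists_coupling (by linarith : 0 < a) hρ hV y t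
  have h1 := tvDist_le_sum_disagree ν hν0 _ (uniformDist (G.Coloring (Fin k))) hνX hνY
  have h2 := sum_le_sqrt_card_mul_l2norm (fun v => ∑ X, ∑ Y, ν X Y * disagree X Y v)
  have h3 := l2norm_scarcity_le G k hk ha hη hρ h
  have h4 : l2norm (fun v => ∑ X, ∑ Y, ν X Y * disagree X Y v) ≤
      ((1 - 1 / (2 * (Fintype.card V : ℝ))) ^ t + 4 * η) * √(Fintype.card V) := by
    linarith
  refine h1.trans (h2.trans ((mul_le_mul_of_nonneg_left h4 (Real.sqrt_nonneg _)).trans ?_))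
  rw [mul_left_comm, Real.mul_self_sqrt (by positivity), mul_comm]

end Coupling

/-! ### Asymptotics of the parameters -/

section Asymptotics

open Filter

lemma exists_forall_large_degree {ε : ℝ} (hε : 0 < ε) (hε2 : ε ≤ 1 / 2) :
    ∃ D : ℝ, ∀ x ≥ D, 1 < x ∧ 12 ≤ x ^ (1 - ε / 2) ∧ 2 * x ^ (1 - ε) ≤ x ^ (1 - ε / 2) ∧
      14 * ε * Real.log x ≤ 4 * x ^ (ε / 8) := by
  have h1 : ∀ᶠ x : ℝ in atTop, 12 ≤ x ^ (1 - ε / 2) :=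
    (tendsto_rpow_atTop (by linarith)).eventually_ge_atTop 12
  have h2 : ∀ᶠ x : ℝ in atTop, 2 ≤ x ^ (ε / 2) :=
    (tendsto_rpow_atTop (by linarith)).eventually_ge_atTop 2
  have h3 : ∀ᶠ x : ℝ in atTop, ‖Real.log x‖ ≤ 4 / (14 * ε) * ‖x ^ (ε / 8)‖ :=
    (isLittleO_log_rpow_atTop (by positivity)).bound (by positivity)
  obtain ⟨D, hD⟩ := eventually_atTop.1
    (h1.and (h2.and (h3.and (eventually_gt_atTop (1 : ℝ)))))
  refine ⟨D, fun x hx => ?_⟩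
  obtain ⟨h1, h2, h3, h4⟩ := hD x hx
  refine ⟨h4, h1, ?_, ?_⟩
  · rw [show 1 - ε / 2 = ε / 2 + (1 - ε) by ring, Real.rpow_add (by linarith)]
    exact mul_le_mul_of_nonneg_right h2 (by positivity)
  · rw [Real.norm_of_nonneg (Real.log_nonneg h4.le), Real.norm_of_nonneg (by positivity),
      div_mul_eq_mul_div, le_div_iff₀ (by positivity)] at h3
    linarith

lemma exists_forall_large_card {ε c : ℝ} (hε : 0 < ε) (hε2 : ε ≤ 1 / 2) (hc : 0 < c) (D : ℝ) :
    ∃ N : ℕ, ∀ n : ℕ, N ≤ n → 32 ≤ n ∧ D ≤ c * Real.log n ^ (1 + ε) ∧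
      Real.log (32 * n) ≤ (c * Real.log n ^ (1 + ε)) ^ (1 - ε / 2) := by
  have hlog : Tendsto (fun n : ℕ => Real.log n) atTop atTop :=
    Real.tendsto_log_atTop.comp tendsto_natCast_atTop_atTop
  have h1 : ∀ᶠ L : ℝ in atTop, D ≤ c * L ^ (1 + ε) :=
    ((tendsto_rpow_atTop (by linarith)).const_mul_atTop hc).eventually_ge_atTop D
  -- The exponent `(1 + ε) * (1 - ε / 2) - 1 = ε * (1 - ε) / 2` is positive.
  have h2 : ∀ᶠ L : ℝ in atTop, 2 ≤ c ^ (1 - ε / 2) * L ^ (ε * (1 - ε) / 2) :=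
    ((tendsto_rpow_atTop (by nlinarith)).const_mul_atTop
      (by positivity)).eventually_ge_atTop 2
  obtain ⟨N, hN⟩ := eventually_atTop.1
    (((hlog.eventually h1).and (hlog.eventually h2)).and (eventually_ge_atTop 32))
  refine ⟨N, fun n hn => ?_⟩
  obtain ⟨⟨h1, h2⟩, h3⟩ := hN n hn
  refine ⟨h3, h1, ?_⟩
  have h3' : (32 : ℝ) ≤ n := by exact_mod_cast h3
  have hL : 0 < Real.log n := Real.log_pos (by linarith)
  have e1 : (c * Real.log n ^ (1 + ε)) ^ (1 - ε / 2) =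
      c ^ (1 - ε / 2) * Real.log n ^ (ε * (1 - ε) / 2) * Real.log n := by
    rw [Real.mul_rpow hc.le (by positivity), ← Real.rpow_mul hL.le, mul_assoc]
    congr 1
    nth_rewrite 3 [← Real.rpow_one (Real.log n)]
    rw [← Real.rpow_add hL]
    congr 1
    ring
  rw [e1, Real.log_mul (by norm_num) (by linarith)]
  have h4 : Real.log 32 ≤ Real.log n := Real.log_le_log (by norm_num) h3'
  nlinarith

end Asymptotics

section Parameters

variable {V : Type*} [Fintype V] [DecidableEq V] {G : SimpleGraph V} [DecidableRel G.Adj]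

/-- As a star with `Δ` leaves has operator norm `√Δ`, the bound on the operator norm forces
`ε ≤ 1 / 2`. -/
lemma le_half_of_graphOpNorm_le {ε : ℝ} (hΔ : 1 < (G.maxDegree : ℝ))
    (hρ : graphOpNorm G ≤ (G.maxDegree : ℝ) ^ (1 - ε)) : ε ≤ 1 / 2 := by
  have hne : Nonempty V := by
    by_contra h
    rw [not_nonempty_iff] at h
    rw [SimpleGraph.maxDegree_of_subsingleton] at hΔ
    norm_num at hΔ
  obtain ⟨v, hv⟩ := G.exists_maximal_degree_vertex
  have h1 := degree_le_graphOpNorm_sq G v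
  rw [← hv] at h1
  have h2 := h1.trans (pow_le_pow_left₀ (graphOpNorm_nonneg G) hρ 2)
  rw [← Real.rpow_natCast, ← Real.rpow_mul (by linarith)] at h2
  nth_rewrite 1 [← Real.rpow_one (G.maxDegree : ℝ)] at h2
  rw [Real.rpow_le_rpow_left_iff hΔ] at h2
  push_cast at h2
  linarith

/-- With `x` the maximum degree, the expected number of colors missing from a neighborhood is at
least `k * exp (-(3 / 2 * x / k)) ≥ k * x ^ (-3 * ε / 8)`, which for large `x` is more than 14 times
the threshold `x ^ (1 - ε / 2)`. -/
lemma fourteen_mul_rpow_le {ε x k : ℝ} (hε : 0 < ε) (hx : 1 < x)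
    (hlog : 14 * ε * Real.log x ≤ 4 * x ^ (ε / 8)) (hk : 4 * ε⁻¹ * x / Real.log x < k) :
    0 < k ∧ 14 * x ^ (1 - ε / 2) ≤ k * Real.exp (-(3 / 2 * x / k)) := by
  have hL : 0 < Real.log x := Real.log_pos hx
  have hx0 : 0 < x := by linarith
  have hk0 : 0 < k := lt_trans (by positivity) hk
  refine ⟨hk0, ?_⟩
  have hk' : 4 * x < k * (ε * Real.log x) := by
    rw [div_lt_iff₀ hL] at hk
    have := mul_lt_mul_of_pos_left hk hε
    calc 4 * x = ε * (4 * ε⁻¹ * x) := by field_simp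
      _ < ε * (k * Real.log x) := this
      _ = _ := by ring
  have h1 : x ^ (-(3 / 8 * ε)) ≤ Real.exp (-(3 / 2 * x / k)) := by
    rw [Real.rpow_def_of_pos hx0]
    refine Real.exp_le_exp.2 ?_
    have : 3 / 2 * x / k ≤ 3 / 8 * (ε * Real.log x) := by
      rw [div_le_iff₀ hk0]
      linarith
    linarith
  have h2 : 14 * x ^ (1 - ε / 2) * (ε * Real.log x) ≤ 4 * x * x ^ (-(3 / 8 * ε)) := by
    calc 14 * x ^ (1 - ε / 2) * (ε * Real.log x)
        = x ^ (1 - ε / 2) * (14 * ε * Real.log x) := by ring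
      _ ≤ x ^ (1 - ε / 2) * (4 * x ^ (ε / 8)) :=
          mul_le_mul_of_nonneg_left hlog (by positivity)
      _ = 4 * (x ^ (1 : ℝ) * x ^ (-(3 / 8 * ε))) := by
          rw [mul_left_comm, ← Real.rpow_add hx0, ← Real.rpow_add hx0]
          congr 2
          ring
      _ = _ := by rw [Real.rpow_one, mul_assoc]
  have h3 : 14 * x ^ (1 - ε / 2) * (ε * Real.log x) ≤
      k * x ^ (-(3 / 8 * ε)) * (ε * Real.log x) := by
    refine h2.trans ?_
    have := mul_le_mul_of_nonneg_right hk'.le (show 0 ≤ x ^ (-(3 / 8 * ε)) by positivity)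
    linarith
  exact (le_of_mul_le_mul_right h3 (by positivity)).trans
    (mul_le_mul_of_nonneg_left h1 hk0.le)

/-- The threshold `a = Δ ^ (1 - ε / 2)` makes the exceptional probability in `scarcity_le` at most
`1 / (32 * n)`. -/
lemma exp_tail_le {ε : ℝ} {k : ℕ} (hΔ : 1 < (G.maxDegree : ℝ))
    (hρ : graphOpNorm G ≤ (G.maxDegree : ℝ) ^ (1 - ε)) (hk : 0 < k)
    (hμ : 14 * (G.maxDegree : ℝ) ^ (1 - ε / 2) ≤
      k * Real.exp (-(3 / 2 * (G.maxDegree : ℝ) / k)))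
    {n : ℝ} (hn : 0 < n) (hlog : Real.log (32 * n) ≤ (G.maxDegree : ℝ) ^ (1 - ε / 2)) (v : V) :
    Real.exp (2 * (G.maxDegree : ℝ) ^ (1 - ε / 2) +
      4 * graphOpNorm G * G.degree v / (G.maxDegree : ℝ) ^ (1 - ε / 2) -
      k * Real.exp (-(3 / 2 * G.degree v / k)) / 2) ≤ 1 / (32 * n) := by
  set x : ℝ := (G.maxDegree : ℝ) with hx
  have hx0 : 0 < x := by linarith
  have hdeg : (G.degree v : ℝ) ≤ x := Nat.cast_le.2 (G.degree_le_maxDegree v)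
  have hk' : (0 : ℝ) < k := by exact_mod_cast hk
  have h1 : 4 * graphOpNorm G * G.degree v / x ^ (1 - ε / 2) ≤ 4 * x ^ (1 - ε / 2) := by
    rw [div_le_iff₀ (by positivity)]
    have e : x ^ (1 - ε) * x = x ^ (1 - ε / 2) * x ^ (1 - ε / 2) := by
      nth_rewrite 2 [← Real.rpow_one x]
      rw [← Real.rpow_add hx0, ← Real.rpow_add hx0]
      congr 1
      ring
    have h2 : graphOpNorm G * G.degree v ≤ x ^ (1 - ε) * x :=
      mul_le_mul hρ hdeg (by positivity) (by positivity)
    rw [e] at h2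
    linarith
  have h2 : k * Real.exp (-(3 / 2 * x / k)) ≤ k * Real.exp (-(3 / 2 * G.degree v / k)) := by
    gcongr
  have h3 : 1 / (32 * n) = Real.exp (-Real.log (32 * n)) := by
    rw [Real.exp_neg, Real.exp_log (by positivity), one_div]
  rw [h3]
  exact Real.exp_le_exp.2 (by linarith)

lemma glauberMixingTime_le {k t : ℕ} (h : ∀ y : G.Coloring (Fin k),
    tvDist ((glauberMatrix G k ^ t) y) (uniformDist (G.Coloring (Fin k))) ≤ 1 / 4) :
    ∃ τ : ℕ, glauberMixingTime G k = (τ : ℕ∞) ∧ τ ≤ t := by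
  have hle : glauberMixingTime G k ≤ (t : ℕ∞) := sInf_le ⟨t, rfl, h⟩
  obtain ⟨τ, hτ⟩ := ENat.ne_top_iff_exists.1 (ne_top_of_le_ne_top (ENat.natCast_ne_top t) hle)
  refine ⟨τ, hτ.symm, ?_⟩
  rw [← hτ] at hle
  exact_mod_cast hle

lemma card_mul_pow_le {n : ℝ} (hn : 32 ≤ n) {t : ℕ} (ht : 2 * n * Real.log (8 * n) ≤ t) :
    n * ((1 - 1 / (2 * n)) ^ t + 4 * (1 / (32 * n))) ≤ 1 / 4 := by
  have hn0 : 0 < n := by linarith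
  have h1 : (1 - 1 / (2 * n)) ^ t ≤ 1 / (8 * n) := by
    have h0 : 0 ≤ 1 - 1 / (2 * n) := by
      rw [sub_nonneg, div_le_one (by positivity)]; linarith
    calc (1 - 1 / (2 * n)) ^ t ≤ Real.exp (-(1 / (2 * n))) ^ t :=
          pow_le_pow_left₀ h0 (Real.one_sub_le_exp_neg _) t
      _ = Real.exp (-(t / (2 * n))) := by
          rw [← Real.exp_nat_mul]; congr 1; ring
      _ ≤ Real.exp (-Real.log (8 * n)) := by
          refine Real.exp_le_exp.2 (neg_le_neg ?_)
          rw [le_div_iff₀ (by positivity)]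
          linarith
      _ = 1 / (8 * n) := by
          rw [Real.exp_neg, Real.exp_log (by positivity), one_div]
  calc n * ((1 - 1 / (2 * n)) ^ t + 4 * (1 / (32 * n)))
      ≤ n * (1 / (8 * n) + 4 * (1 / (32 * n))) := by gcongr
    _ = 1 / 4 := by field_simp; norm_num

end Parameters

/-! ### Rapid mixing -/

theorem theorem1p1 (ε : ℝ) (hε : 0 < ε) (c : ℝ) (hc : 0 < c) :
    ∃ (C : ℝ) (N : ℕ), ∀ (V : Type*) [Fintype V] [DecidableEq V] (G : SimpleGraph V)
      [DecidableRel G.Adj] (k : ℕ),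
      N ≤ Fintype.card V →
      graphOpNorm G ≤ (G.maxDegree : ℝ) ^ (1 - ε) →
      c * Real.log (Fintype.card V) ^ (1 + ε) ≤ (G.maxDegree : ℝ) →
      4 * ε⁻¹ * (G.maxDegree : ℝ) / Real.log (G.maxDegree : ℝ) < (k : ℝ) →
      G.Colorable k ∧
        ∃ t : ℕ, glauberMixingTime G k = (t : ℕ∞) ∧
          (t : ℝ) ≤ C * (Fintype.card V : ℝ) * Real.log (Fintype.card V) := by
  by_cases hε2 : ε ≤ 1 / 2
  swap
  · -- For large `n` no graph satisfies the hypotheses, since they imply `Δ > 1`.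
    obtain ⟨N, hN⟩ := exists_forall_large_card (ε := 1 / 2) (by norm_num) le_rfl hc 2
    refine ⟨0, max N 3, fun V _ _ G _ k hn hρ hΔ hk => absurd ?_ hε2⟩
    obtain ⟨-, h2, -⟩ := hN _ (le_trans (le_max_left _ _) hn)
    have h3 : (3 : ℝ) ≤ Fintype.card V := by exact_mod_cast le_trans (le_max_right _ _) hn
    have hL : 1 ≤ Real.log (Fintype.card V) := by
      rw [Real.le_log_iff_exp_le (by linarith)]
      have := Real.exp_one_lt_d9
      linarith
    have h4 : Real.log (Fintype.card V) ^ (1 + 1 / 2 : ℝ) ≤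
        Real.log (Fintype.card V) ^ (1 + ε) :=
      Real.rpow_le_rpow_of_exponent_le hL (by linarith)
    have h5 := mul_le_mul_of_nonneg_left h4 hc.le
    exact le_half_of_graphOpNorm_le (by linarith) hρ
  obtain ⟨D, hD⟩ := exists_forall_large_degree hε hε2
  obtain ⟨N, hN⟩ := exists_forall_large_card hε hε2 hc (max D 1)
  refine ⟨5, N, fun V _ _ G _ k hn hρ hΔ hk => ?_⟩
  obtain ⟨hn32, hDn, hlog⟩ := hN _ hn
  obtain ⟨hx1, hx12, hx2, hxlog⟩ := hD (G.maxDegree : ℝ) ((le_max_left D 1).trans (hDn.trans hΔ))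
  obtain ⟨hk0, hμ⟩ := fourteen_mul_rpow_le hε hx1 hxlog hk
  have hk0' : 0 < k := by exact_mod_cast hk0
  have hn32' : (32 : ℝ) ≤ Fintype.card V := by exact_mod_cast hn32
  set n : ℝ := (Fintype.card V : ℝ) with hnn
  have hlog' : Real.log (32 * n) ≤ (G.maxDegree : ℝ) ^ (1 - ε / 2) :=
    hlog.trans (Real.rpow_le_rpow (by linarith [le_max_right D 1]) hΔ (by linarith))
  have hρ2 : 2 * graphOpNorm G ≤ (G.maxDegree : ℝ) ^ (1 - ε / 2) := by linarith
  have hcol : G.Colorable k := by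
    refine colorable_of_graphOpNorm_lt G ?_
    have h1 : Real.exp (-(3 / 2 * (G.maxDegree : ℝ) / k)) ≤ 1 :=
      Real.exp_le_one_iff.2 (neg_nonpos.2 (by positivity))
    have h2 := mul_le_mul_of_nonneg_left h1 hk0.le
    linarith [graphOpNorm_nonneg G]
  refine ⟨hcol, ?_⟩
  have hne : Nonempty (G.Coloring (Fin k)) := hcol
  obtain ⟨τ, hτ, hτt⟩ := glauberMixingTime_le (G := G) (k := k) (t := ⌈2 * n * Real.log (8 * n)⌉₊)
    fun y => (tvDist_glauberMatrix_pow_le hk0' hx12 (by positivity) hρ2 (by omega)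
      (exp_tail_le hx1 hρ hk0' hμ (by linarith) hlog') y _).trans
        (card_mul_pow_le hn32' (Nat.le_ceil _))
  refine ⟨τ, hτ, ?_⟩
  have hL8 : Real.log (8 * n) ≤ 2 * Real.log n := by
    rw [Real.log_mul (by norm_num) (by linarith)]
    have : Real.log 8 ≤ Real.log n := Real.log_le_log (by norm_num) (by linarith)
    linarith
  have hL1 : 1 ≤ Real.log n := by
    rw [Real.le_log_iff_exp_le (by linarith)]
    have := Real.exp_one_lt_d9
    linarith
  have hL80 : 0 ≤ Real.log (8 * n) := Real.log_nonneg (by linarith)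
  have hceil := Nat.ceil_lt_add_one (show 0 ≤ 2 * n * Real.log (8 * n) by positivity)
  have hτ' : (τ : ℝ) ≤ (⌈2 * n * Real.log (8 * n)⌉₊ : ℝ) := by exact_mod_cast hτt
  have h1 : 2 * n * Real.log (8 * n) ≤ 2 * n * (2 * Real.log n) :=
    mul_le_mul_of_nonneg_left hL8 (by linarith)
  nlinarith
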